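/- For a category $\mathcal C$, let $\mathrm{diff}\,\mathcal C$ be the category whose objects are pairs $X=(\lfloor X\rfloor,\sigma_X)$ with $\lfloor X\rfloor\in\mathcal C$ and $\sigma_X:\lfloor X\rfloor\to\lfloor X\rfloor$ a morphism, and whose morphisms $f:X\to Y$ are the morphisms $\lfloor f\rfloor:\lfloor X\rfloor\to\lfloor Y\rfloor$ of $\mathcal C$ with $\lfloor f\rfloor\circ\sigma_X=\sigma_Y\circ\lfloor f\rfloor$. **Definitions.** Let $S:\mathcal A\to\mathcal P$ be left adjoint to $C:\mathcal P\to\mathcal A$, with unit $\eta$, where $\mathcal A$ has pullbacks. For $X\in\mathcal A$ this induces an adjunction $S_X\dashv C_X$ between $\mathcal A_{/X}$ and $\mathcal P_{/S(X)}$, where $S_X(a)=S(a)$ and $C_X(e)$ is the pullback of $C(e)$ along $\eta_X:X\to CS(X)$. For $f:X\to Y$ in $\mathcal A$ let $f^*:\mathcal A_{/Y}\to\mathcal A_{/X}$ be the pullback functor and $f_!$, $f_!(a)=f\circ a$, its left adjoint. An object $a\in\mathcal A_{/Y}$ is *split by $f$* if the unit $f^*a\to C_XS_X(f^*a)$ of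 $S_X\dashv C_X$ is an isomorphism; $\mathrm{Split}_Y(f)$ is the full subcategory of $\mathcal A_{/Y}$ on these objects. The morphism $f$ is *of relative Galois descent* if (1) $f^*$ is monadic; (2) the counit $S_XC_X\to\mathrm{id}$ is an isomorphism; (3) for every $e\in\mathcal P_{/S(X)}$ the object $f_!\,C_X(e)$ is split by $f$. **Theorem.** Let $S_0:\mathcal A_0\to\mathcal P_0$ be left adjoint to $C_0:\mathcal P_0\to\mathcal A_0$, where $\mathcal A_0$ has pullbacks. Put $\mathcal A=\mathrm{diff}\,\mathcal A_0$ and $\mathcal P=\mathrm{diff}\,\mathcal P_0$, and let $S\dashv C$ be the induced adjunction, $S(X)=(S_0\lfloor X\rfloor,S_0(\sigma_X))$ and $C(E)=(C_0\lfloor E\rfloor,C_0(\sigma_E))$. Let $f:X\to Y$ be a morphism of $\mathcal A$ such that $\lfloor f\rfloor$ is of relative Galois descent for $S_0\dashv C_0$. Then: 1. $f$ is of relative Galois descent for $S\dashv C$. 2. An object $a$ of $\mathcal A_{/Y}$ is split by $f$ if and only if $\lfloor a\rfloor\in(\mathcal A_0)_{/\lfloor Y\rfloor}$ is split by $\lfloor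 f\rfloor$. 3. The image under $S$ of the kernel pair groupoid of $f$ is an internal groupoid $$\mathrm{Gal}[f]=\bigl(S(X\times_YX)\rightrightarrows S(X)\bigr)$$ in $\mathcal P$, in which $(x,y)\in X\times_YX$ is regarded as a morphism from $y$ to $x$, the identities are given by the diagonal, the inversion by the interchange of the two factors and the composition by $((x,y),(y,z))\mapsto(x,z)$; in particular the pullback $S(X\times_YX)\times_{S(X)}S(X\times_YX)$ exists in $\mathcal P$ and is $S(X\times_YX\times_YX)$. 4. There is an equivalence of categories $$\mathrm{Split}_Y(f)\simeq[\mathrm{Gal}[f],\mathcal P]$$ with the category of actions of $\mathrm{Gal}[f]$ in $\mathcal P$, that is, of objects $F\to S(X)$ over $S(X)$ together with an associative and unital action $S(X\times_YX)\times_{S(X)}F\to F$ (defined on the pullback along the source map, and covering the target map). It is realised by the functor $A\mapsto S(X\times_YA)$: the composite of the equivalence with the forgetful functor to $\mathcal P_{/S(X)}$ is isomorphic to $A\mapsto S_X(f^*A)$, by an isomorphism that identifies the action on $S(X\times_YA)$ with the one induced by the projection $X\times_YX\times_YA\to X\times_YA$, $(x,y,a)\mapsto(x,a)$. -/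

import Mathlib

open CategoryTheory CategoryTheory.Limits

universe v u v₁ u₁ v₂ u₂

/-! ### Difference objects -/

/-- A difference object of `C`: an object together with an endomorphism of it. -/
structure DiffObj (C : Type u) [Category.{v} C] where
  /-- the underlying object -/
  pt : C
  /-- the difference operator -/
  σ : pt ⟶ pt

namespace DiffObj

section

variable {C : Type u} [Category.{v} C]

/-- A morphism of difference objects: a morphism of the underlying objects that commutes with
the difference operators. -/
@[ext]
structure Hom (X Y : DiffObj C) where
  /-- the underlying morphism -/
  hom : X.pt ⟶ Y.pt
  comm : hom ≫ Y.σ = X.σ ≫ hom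

/-- The category of difference objects of `C`. -/
@[simps id_hom comp_hom]
instance : Category (DiffObj C) where
  Hom := Hom
  id X := { hom := 𝟙 X.pt, comm := by simp }
  comp f g :=
    { hom := f.hom ≫ g.hom
      comm := by rw [Category.assoc, g.comm, ← Category.assoc, f.comm, Category.assoc] }

@[ext]
theorem hom_ext {X Y : DiffObj C} {f g : X ⟶ Y} (h : f.hom = g.hom) : f = g :=
  Hom.ext h

/-- The forgetful functor from difference objects to underlying objects. -/
@[simps]
def forget (C : Type u) [Category.{v} C] : DiffObj C ⥤ C where
  obj X := X.pt
  map f := f.hom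

/-- A pullback of underlying objects, with the induced difference operator, is a pullback of
difference objects. -/
theorem hasPullback_of_isPullback {X Y Z : DiffObj C} {f : X ⟶ Z} {g : Y ⟶ Z} {p : C}
    {a : p ⟶ X.pt} {b : p ⟶ Y.pt} (h : IsPullback a b f.hom g.hom) : HasPullback f g := by
  have w : (a ≫ X.σ) ≫ f.hom = (b ≫ Y.σ) ≫ g.hom := by
    rw [Category.assoc, Category.assoc, ← f.comm, ← g.comm, h.w_assoc]
  let p' : DiffObj C := ⟨p, h.lift (a ≫ X.σ) (b ≫ Y.σ) w⟩
  let a' : p' ⟶ X := ⟨a, (h.lift_fst _ _ w).symm⟩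
  let b' : p' ⟶ Y := ⟨b, (h.lift_snd _ _ w).symm⟩
  have h' : IsPullback a' b' f g :=
    { w := hom_ext h.w
      isLimit' := ⟨PullbackCone.IsLimit.mk _
        (fun s =>
          { hom := h.lift s.fst.hom s.snd.hom (congrArg Hom.hom s.condition)
            comm := h.hom_ext
              (by
                rw [Category.assoc, Category.assoc, h.lift_fst, h.lift_fst, h.lift_fst_assoc]
                exact s.fst.comm)
              (by
                rw [Category.assoc, Category.assoc, h.lift_snd, h.lift_snd, h.lift_snd_assoc]
                exact s.snd.comm) })
        (fun s => hom_ext (h.lift_fst _ _ _))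
        (fun s => hom_ext (h.lift_snd _ _ _))
        (fun s m h₁ h₂ => hom_ext (h.hom_ext
          ((congrArg Hom.hom h₁).trans (h.lift_fst _ _ _).symm)
          ((congrArg Hom.hom h₂).trans (h.lift_snd _ _ _).symm)))⟩ }
  exact h'.hasPullback

/-- If `C` has pullbacks, so does its category of difference objects. -/
instance hasPullbacks [HasPullbacks C] : HasPullbacks (DiffObj C) := by
  have key : ∀ {X Y Z : DiffObj C} {f : X ⟶ Z} {g : Y ⟶ Z}, HasLimit (cospan f g) :=
    fun {_ _ _ f g} => hasPullback_of_isPullback (IsPullback.of_hasPullback f.hom g.hom)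
  exact hasPullbacks_of_hasLimit_cospan (DiffObj C)

end

section

variable {C : Type u₁} [Category.{v₁} C] {D : Type u₂} [Category.{v₂} D]

/-- The functor induced on difference objects: `(X, σ) ↦ (F X, F σ)`. -/
@[simps]
def mapFunctor (F : C ⥤ D) : DiffObj C ⥤ DiffObj D where
  obj X := { pt := F.obj X.pt, σ := F.map X.σ }
  map f := { hom := F.map f.hom, comm := by rw [← F.map_comp, f.comm, F.map_comp] }
  map_id X := hom_ext (F.map_id X.pt)
  map_comp f g := hom_ext (F.map_comp f.hom g.hom)

/-- The adjunction induced on difference objects; its unit and counit are those of the given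
adjunction. -/
@[simps]
def mapAdjunction {F : C ⥤ D} {G : D ⥤ C} (adj : F ⊣ G) : mapFunctor F ⊣ mapFunctor G where
  unit :=
    { app X := { hom := adj.unit.app X.pt, comm := (adj.unit.naturality X.σ).symm }
      naturality _ _ f := hom_ext (adj.unit.naturality f.hom) }
  counit :=
    { app X := { hom := adj.counit.app X.pt, comm := (adj.counit.naturality X.σ).symm }
      naturality _ _ f := hom_ext (adj.counit.naturality f.hom) }
  left_triangle_components X := hom_ext (adj.left_triangle_components X.pt)
  right_triangle_components X := hom_ext (adj.right_triangle_components X.pt)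

end

end DiffObj

/-! ### Internal groupoids and their actions -/

/-- The raw data of an internal groupoid: objects `C₀`, morphisms `C₁`, composable pairs `C₂`,
with source `d₀`, target `d₁`, identities `e`, inversion `i` and composition `m`. A composable
pair is a pair `(π₁, π₂)` of morphisms such that the source of `π₁` is the target of `π₂`, and
`m` sends it to the composite of `π₂` followed by `π₁`. -/
structure InternalGroupoidData (C : Type u) [Category.{v} C] where
  /-- objects -/
  C₀ : C
  /-- morphisms -/
  C₁ : C
  /-- composable pairs -/
  C₂ : C
  /-- source -/
  d₀ : C₁ ⟶ C₀
  /-- target -/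
  d₁ : C₁ ⟶ C₀
  /-- identities -/
  e : C₀ ⟶ C₁
  /-- inversion -/
  i : C₁ ⟶ C₁
  /-- the left member of a composable pair -/
  π₁ : C₂ ⟶ C₁
  /-- the right member of a composable pair -/
  π₂ : C₂ ⟶ C₁
  /-- composition -/
  m : C₂ ⟶ C₁

/-- The image under a functor of the raw data of an internal groupoid. -/
@[simps]
abbrev InternalGroupoidData.map {C : Type u₁} [Category.{v₁} C] {D : Type u₂} [Category.{v₂} D]
    (G : InternalGroupoidData C) (F : C ⥤ D) : InternalGroupoidData D where
  C₀ := F.obj G.C₀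
  C₁ := F.obj G.C₁
  C₂ := F.obj G.C₂
  d₀ := F.map G.d₀
  d₁ := F.map G.d₁
  e := F.map G.e
  i := F.map G.i
  π₁ := F.map G.π₁
  π₂ := F.map G.π₂
  m := F.map G.m

/-- The axioms of an internal groupoid. The object of composable pairs has to be the pullback
`C₁ ×_{C₀} C₁`. Associativity is the equality of the two composites of every composable triple
`T ⟶ C₁` of generalized elements, equivalently of the universal one, on `C₁ ×_{C₀} C₁ ×_{C₀} C₁`,
when this pullback exists. -/
structure InternalGroupoidData.IsGroupoid {C : Type u} [Category.{v} C]
    (G : InternalGroupoidData C) : Prop where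
  isPullback : IsPullback G.π₁ G.π₂ G.d₀ G.d₁
  e_d₀ : G.e ≫ G.d₀ = 𝟙 G.C₀
  e_d₁ : G.e ≫ G.d₁ = 𝟙 G.C₀
  m_d₀ : G.m ≫ G.d₀ = G.π₂ ≫ G.d₀
  m_d₁ : G.m ≫ G.d₁ = G.π₁ ≫ G.d₁
  comp_id : isPullback.lift (𝟙 G.C₁) (G.d₀ ≫ G.e) (by simp [e_d₁]) ≫ G.m = 𝟙 G.C₁
  id_comp : isPullback.lift (G.d₁ ≫ G.e) (𝟙 G.C₁) (by simp [e_d₀]) ≫ G.m = 𝟙 G.C₁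
  assoc : ∀ {T : C} (f g h : T ⟶ G.C₁) (hfg : f ≫ G.d₀ = g ≫ G.d₁) (hgh : g ≫ G.d₀ = h ≫ G.d₁),
    isPullback.lift (isPullback.lift f g hfg ≫ G.m) h (by simp [m_d₀, hgh]) ≫ G.m =
      isPullback.lift f (isPullback.lift g h hgh ≫ G.m) (by simp [m_d₁, hfg]) ≫ G.m
  i_d₀ : G.i ≫ G.d₀ = G.d₁
  i_d₁ : G.i ≫ G.d₁ = G.d₀
  comp_inv : isPullback.lift (𝟙 G.C₁) G.i (by simp [i_d₁]) ≫ G.m = G.d₁ ≫ G.e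
  inv_comp : isPullback.lift G.i (𝟙 G.C₁) (by simp [i_d₀]) ≫ G.m = G.d₀ ≫ G.e

/-- An internal groupoid in `C`. -/
structure InternalGroupoid (C : Type u) [Category.{v} C] extends InternalGroupoidData C where
  isGroupoid : toInternalGroupoidData.IsGroupoid

/-- An action of an internal groupoid `G` in `C` (an internal diagram on `G`). The pullback
`F₁ = C₁ ×_{C₀} F₀` on which the action `μ` is defined is not required to be a particular chosen
one, so that `C` need not have all pullbacks. Compatibility with composition is stated on
generalized elements `T ⟶ C₁`, `T ⟶ C₁`, `T ⟶ F₀`. -/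
structure InternalAction {C : Type u} [Category.{v} C] (G : InternalGroupoid C) where
  /-- the total object -/
  F₀ : C
  /-- the structure morphism -/
  γ : F₀ ⟶ G.C₀
  /-- the domain of the action -/
  F₁ : C
  /-- the projection to the groupoid -/
  fst : F₁ ⟶ G.C₁
  /-- the projection to the total object -/
  snd : F₁ ⟶ F₀
  isPullback : IsPullback fst snd G.d₀ γ
  /-- the action -/
  μ : F₁ ⟶ F₀
  μ_γ : μ ≫ γ = fst ≫ G.d₁
  one_act : isPullback.lift (γ ≫ G.e) (𝟙 F₀) (by simp [G.isGroupoid.e_d₀]) ≫ μ = 𝟙 F₀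
  comp_act : ∀ {T : C} (f g : T ⟶ G.C₁) (a : T ⟶ F₀) (hfg : f ≫ G.d₀ = g ≫ G.d₁)
    (hga : g ≫ G.d₀ = a ≫ γ),
    isPullback.lift (G.isGroupoid.isPullback.lift f g hfg ≫ G.m) a
        (by simp [G.isGroupoid.m_d₀, hga]) ≫ μ =
      isPullback.lift f (isPullback.lift g a hga ≫ μ) (by simp [μ_γ, hfg]) ≫ μ

namespace InternalAction

variable {C : Type u} [Category.{v} C] {G : InternalGroupoid C}

/-- A morphism of actions: a morphism of total objects over `C₀` that commutes with the actions. -/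
@[ext]
structure Hom (F F' : InternalAction G) where
  /-- the morphism of total objects -/
  hom : F.F₀ ⟶ F'.F₀
  w : hom ≫ F'.γ = F.γ
  comm : F.μ ≫ hom =
    F'.isPullback.lift F.fst (F.snd ≫ hom) (by simp [w, F.isPullback.w]) ≫ F'.μ

/-- The category `[G, C]` of actions of `G` in `C`. -/
@[simps id_hom comp_hom]
instance : Category (InternalAction G) where
  Hom := Hom
  id F :=
    { hom := 𝟙 F.F₀
      w := by simp
      comm := by
        have h : F.isPullback.lift F.fst (F.snd ≫ 𝟙 F.F₀) (by simp [F.isPullback.w]) = 𝟙 F.F₁ := by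
          apply F.isPullback.hom_ext <;> simp
        rw [h]; simp }
  comp {F F' F''} f g :=
    { hom := f.hom ≫ g.hom
      w := by rw [Category.assoc, g.w, f.w]
      comm := by
        rw [← Category.assoc, f.comm, Category.assoc, g.comm, ← Category.assoc]
        congr 1
        apply F''.isPullback.hom_ext <;> simp }

/-- The functor sending an action to its structure morphism. -/
@[simps]
def toOver (G : InternalGroupoid C) : InternalAction G ⥤ Over G.C₀ where
  obj F := Over.mk F.γ
  map f := Over.homMk f.hom f.w

end InternalAction

/-! ### Categorical Galois theory -/

namespace Janelidze

variable {A : Type u₁} [Category.{v₁} A] {P : Type u₂} [Category.{v₂} P] [HasPullbacks A]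
  {S : A ⥤ P} {C : P ⥤ A}

/-- The functor `S_X` from the slice over `X` to the slice over `S X`, sending `a` to `S a`. -/
abbrev sliceS (S : A ⥤ P) (X : A) : Over X ⥤ Over (S.obj X) :=
  Over.post S

/-- The functor `C_X` from the slice over `S X` to the slice over `X`, sending `e` to the pullback
of `C e` along the unit `X ⟶ C (S X)`. -/
noncomputable abbrev sliceC (adj : S ⊣ C) (X : A) : Over (S.obj X) ⥤ Over X :=
  Over.post C ⋙ Over.pullback (adj.unit.app X)

/-- The adjunction `S_X ⊣ C_X` between slices induced by an adjunction `S ⊣ C`. -/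
noncomputable abbrev sliceAdj (adj : S ⊣ C) (X : A) : sliceS S X ⊣ sliceC adj X :=
  Over.postAdjunctionLeft adj

/-- An object `a` over `Y` is split by `f : X ⟶ Y` if the unit of `S_X ⊣ C_X` is an isomorphism
at the pullback of `a` along `f`. -/
def IsSplit (adj : S ⊣ C) {X Y : A} (f : X ⟶ Y) : ObjectProperty (Over Y) := fun a =>
  IsIso ((sliceAdj adj X).unit.app ((Over.pullback f).obj a))

/-- The full subcategory `Split_Y(f)` of the slice over `Y`, on the objects split by `f`. -/
abbrev Split (adj : S ⊣ C) {X Y : A} (f : X ⟶ Y) :=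
  (IsSplit adj f).FullSubcategory

/-- The morphism `f : X ⟶ Y` is of relative Galois descent: `f^*` is monadic, the counit of
`S_X ⊣ C_X` is an isomorphism, and for every `E` over `S X` the object `f_! (C_X E)` is split
by `f`. -/
structure IsRelativeGaloisDescent (adj : S ⊣ C) {X Y : A} (f : X ⟶ Y) : Prop where
  monadic : Nonempty (MonadicRightAdjoint (Over.pullback f))
  isIso_counit : IsIso (sliceAdj adj X).counit
  isSplit : ∀ E : Over (S.obj X), IsSplit adj f ((Over.map f).obj ((sliceC adj X).obj E))

/-- The data of the kernel pair groupoid of `f : X ⟶ Y`: the object of objects is `X`, the object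
of morphisms is `X ×_Y X`, and `(x, y)` is a morphism from `y` to `x`. Composition is
`((x, y), (y, z)) ↦ (x, z)`, identities are the diagonal, inversion is the interchange. -/
@[simps]
noncomputable abbrev kernelPairData {X Y : A} (f : X ⟶ Y) : InternalGroupoidData A where
  C₀ := X
  C₁ := pullback f f
  C₂ := pullback (pullback.snd f f) (pullback.fst f f)
  d₀ := pullback.snd f f
  d₁ := pullback.fst f f
  e := pullback.lift (𝟙 X) (𝟙 X) rfl
  i := pullback.lift (pullback.snd f f) (pullback.fst f f) pullback.condition.symm
  π₁ := pullback.fst _ _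
  π₂ := pullback.snd _ _
  m := pullback.lift (pullback.fst _ _ ≫ pullback.fst f f) (pullback.snd _ _ ≫ pullback.snd f f)
    (by
      rw [Category.assoc, Category.assoc, ← pullback.condition (f := f) (g := f),
        pullback.condition (f := f) (g := f), pullback.condition_assoc,
        pullback.condition (f := f) (g := f)])

/-- The data of the Galois groupoid `Gal[f] = (S (X ×_Y X) ⇉ S X)`: the image under `S` of the
kernel pair groupoid of `f`. -/
noncomputable abbrev galData (S : A ⥤ P) {X Y : A} (f : X ⟶ Y) : InternalGroupoidData P :=
  (kernelPairData f).map S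

/-- The morphism `X ×_Y X ×_Y A ⟶ X ×_Y A`, `(x, y, a) ↦ (x, a)`, for an object `a : A ⟶ Y`
over `Y`. -/
noncomputable def kernelPairAct {X Y : A} (f : X ⟶ Y) (a : Over Y) :
    pullback (pullback.snd f f) (pullback.snd a.hom f) ⟶ pullback a.hom f :=
  pullback.lift (pullback.snd _ _ ≫ pullback.fst a.hom f) (pullback.fst _ _ ≫ pullback.fst f f)
    (by
      rw [Category.assoc, Category.assoc, pullback.condition (f := a.hom) (g := f),
        pullback.condition (f := f) (g := f), pullback.condition_assoc])

/-- For an object `a : A ⟶ Y` over `Y` and an action `F` of `Gal[f]` whose total object is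
identified by `θ` with `S (X ×_Y A)` over `S X`, the action is the one induced by the projection
`X ×_Y X ×_Y A ⟶ X ×_Y A`, `(x, y, a) ↦ (x, a)`. -/
def IsCanonicalAction {X Y : A} (f : X ⟶ Y) (hG : (galData S f).IsGroupoid) (a : Over Y)
    (F : InternalAction ⟨galData S f, hG⟩)
    (θ : (InternalAction.toOver _).obj F ≅ (sliceS S X).obj ((Over.pullback f).obj a)) : Prop :=
  F.isPullback.lift (S.map (pullback.fst (pullback.snd f f) (pullback.snd a.hom f)))
      (S.map (pullback.snd (pullback.snd f f) (pullback.snd a.hom f)) ≫ θ.inv.left)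
      (((S.map_comp _ _).symm.trans
        ((congrArg (fun k => S.map k) pullback.condition).trans (S.map_comp _ _))).trans
          ((congrArg (fun k => S.map (pullback.snd _ _) ≫ k) (Over.w θ.inv).symm).trans
            (Category.assoc _ _ _).symm)) ≫ F.μ ≫ θ.hom.left =
    S.map (kernelPairAct f a)

end Janelidze

open Janelidze

/-! The proof has two independent halves: Galois theory for any morphism of relative Galois descent
(`IsRelativeGaloisDescent.exists_equivalence`), and the passage of that property from the underlying
morphism to the morphism of difference objects (`DiffObj.isRelativeGaloisDescent`).

For the first half, call an object over X trivial if the unit of S_X ⊣ C_X is invertible at it.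
Since the counit is invertible, S_X is fully faithful on maps into trivial objects, reaches every
object over S(X) from a trivial one, and preserves products of trivial objects, that is, their fibre
products over X (`IsTrivial.isPullback_map`). By condition (3), f^*f_! keeps objects trivial, so
both projections of the kernel pair are trivial. Hence S preserves every pullback that occurs in the
kernel pair groupoid and in its actions on trivial objects: Gal[f] is a groupoid, and actions on
trivial objects correspond to actions of Gal[f]. On the other side f^*f_! b is X ×_Y B, so an action
of the kernel pair groupoid is an algebra for the monad f^*f_!, and monadicity makes such an action
the same as an object over Y. That object is split exactly when the object acted upon is trivial.

For the second half, pullbacks and isomorphisms of difference objects are detected on underlying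
objects, which settles splitness and conditions (2) and (3). Condition (1) follows from Beck's
theorem. A coequalizer of underlying objects over Y has to receive a difference operator, which lies
over σ_Y and so is not a morphism of the slice; it exists because composition with σ_Y is a left
adjoint between slices and preserves coequalizers. -/

namespace CategoryTheory

/-! ### Monadicity for an arbitrary left adjoint -/

section Monadic

variable {A : Type u₁} [Category.{v₁} A] {B : Type u₂} [Category.{v₁} B] {F : A ⥤ B} {G : B ⥤ A}

/-- The comparison functor of any adjunction whose right adjoint is monadic is an equivalence. -/
theorem Monad.isEquivalence_comparison_of_monadic (adj : F ⊣ G)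
    (h : Nonempty (MonadicRightAdjoint G)) : (Monad.comparison adj).IsEquivalence := by
  obtain ⟨_⟩ := h
  -- The given monadic structure has its own left adjoint, but creation of G-split coequalizers
  -- concerns G alone, so Beck's theorem applies to `adj`.
  have : Monad.CreatesColimitOfIsSplitPair G :=
    ⟨fun f g => Monad.createsGSplitCoequalizersOfMonadic G f g⟩
  exact (Monad.monadicOfCreatesGSplitCoequalizers adj).eqv

end Monadic

/-! ### Adjunctions with invertible counit -/

namespace Adjunction

variable {A : Type u₁} [Category.{v₁} A] {B : Type u₂} [Category.{v₂} B] {L : A ⥤ B} {R : B ⥤ A}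

/-- Naturality of the unit recovers u ≫ η_y from L u, and η_y can be cancelled. -/
theorem left_map_injective_of_isIso_unit (adj : L ⊣ R) (x y : A) (hy : IsIso (adj.unit.app y)) :
    Function.Injective (L.map : (x ⟶ y) → _) := fun u v h => by
  rw [← cancel_mono (adj.unit.app y)]
  have hu := adj.unit.naturality u
  have hv := adj.unit.naturality v
  simp only [Functor.id_map, Functor.comp_map] at hu hv
  rw [hu, hv, h]

/-- The preimage of w is its transpose followed by the inverse of η_y; L takes that inverse to the
counit at L y. -/
theorem left_map_surjective_of_isIso_unit (adj : L ⊣ R) (x y : A) (hy : IsIso (adj.unit.app y)) :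
    Function.Surjective (L.map : (x ⟶ y) → _) := fun w => by
  refine ⟨adj.unit.app x ≫ R.map w ≫ inv (adj.unit.app y), ?_⟩
  have h : L.map (inv (adj.unit.app y)) = adj.counit.app (L.obj y) := by
    rw [Functor.map_inv, IsIso.inv_eq_of_hom_inv_id]
    simp
  rw [L.map_comp, L.map_comp, h]
  simp

/-- The monad is idempotent: by the triangle identities both sides are sections of the same
invertible arrow. -/
theorem map_unit_eq_unit (adj : L ⊣ R) (hε : IsIso adj.counit) (p : A) :
    R.map (L.map (adj.unit.app p)) = adj.unit.app (R.obj (L.obj p)) := by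
  rw [← cancel_mono (R.map (adj.counit.app (L.obj p))), ← R.map_comp]
  simp

theorem isIso_unit_app_obj (adj : L ⊣ R) (hε : IsIso adj.counit) (y : B) :
    IsIso (adj.unit.app (R.obj y)) :=
  isIso_of_comp_hom_eq_id (R.map (adj.counit.app y)) (adj.right_triangle_components y)

/-- If the right adjoint is fully faithful, the objects at which the unit is an isomorphism are
closed under binary products. -/
theorem isIso_unit_of_bijective (adj : L ⊣ R) (hε : IsIso adj.counit) {a b p : A}
    (ha : IsIso (adj.unit.app a)) (hb : IsIso (adj.unit.app b)) {p₁ : p ⟶ a} {p₂ : p ⟶ b}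
    (h : ∀ t : A, Function.Bijective fun w : t ⟶ p => (w ≫ p₁, w ≫ p₂)) :
    IsIso (adj.unit.app p) := by
  -- The inverse of the unit at p is assembled from its two components, using the inverse units at a
  -- and b.
  obtain ⟨r, hr⟩ := (h (R.obj (L.obj p))).2
    (R.map (L.map p₁) ≫ inv (adj.unit.app a), R.map (L.map p₂) ≫ inv (adj.unit.app b))
  obtain ⟨hr₁, hr₂⟩ := Prod.mk.injEq .. ▸ hr
  have n₁ := adj.unit.naturality p₁
  have n₂ := adj.unit.naturality p₂
  have n := adj.unit.naturality r
  simp only [Functor.id_map, Functor.comp_map] at n₁ n₂ n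
  have e : adj.unit.app p ≫ r = 𝟙 p := by
    refine (h p).1 (Prod.ext ?_ ?_)
    · simp only [Category.assoc, hr₁]
      rw [← reassoc_of% n₁, IsIso.hom_inv_id, Category.comp_id, Category.id_comp]
    · simp only [Category.assoc, hr₂]
      rw [← reassoc_of% n₂, IsIso.hom_inv_id, Category.comp_id, Category.id_comp]
  refine ⟨r, e, ?_⟩
  -- By idempotence the other composite is the image under R L of η_p ≫ r, already known to be the
  -- identity.
  rw [n, ← adj.map_unit_eq_unit hε, ← Functor.map_comp, ← Functor.map_comp, e]
  simp

/-- If the right adjoint is fully faithful, the left adjoint preserves binary products of objects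
at which the unit is an isomorphism. -/
theorem bijective_map_of_isIso_unit (adj : L ⊣ R) (hε : IsIso adj.counit) {a b p : A}
    (ha : IsIso (adj.unit.app a)) (hb : IsIso (adj.unit.app b)) {p₁ : p ⟶ a} {p₂ : p ⟶ b}
    (h : ∀ t : A, Function.Bijective fun w : t ⟶ p => (w ≫ p₁, w ≫ p₂)) (t : B) :
    Function.Bijective fun w : t ⟶ L.obj p => (w ≫ L.map p₁, w ≫ L.map p₂) := by
  have hp := adj.isIso_unit_of_bijective hε ha hb h
  constructor
  · intro m m' hm
    obtain ⟨h₁, h₂⟩ := Prod.mk.injEq .. ▸ hm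
    -- Along the invertible counit, maps t ⟶ L p become maps L R t ⟶ L p, and these come from unique
    -- maps R t ⟶ p.
    obtain ⟨w, hw⟩ := adj.left_map_surjective_of_isIso_unit _ _ hp (adj.counit.app t ≫ m)
    obtain ⟨w', hw'⟩ := adj.left_map_surjective_of_isIso_unit _ _ hp (adj.counit.app t ≫ m')
    rw [← cancel_epi (adj.counit.app t), ← hw, ← hw']
    congr 1
    refine (h _).1 (Prod.ext ?_ ?_)
    · apply adj.left_map_injective_of_isIso_unit _ _ ha
      simp [hw, hw', h₁]
    · apply adj.left_map_injective_of_isIso_unit _ _ hb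
      simp [hw, hw', h₂]
  · rintro ⟨u, v⟩
    obtain ⟨u', hu⟩ := adj.left_map_surjective_of_isIso_unit _ _ ha (adj.counit.app t ≫ u)
    obtain ⟨v', hv⟩ := adj.left_map_surjective_of_isIso_unit _ _ hb (adj.counit.app t ≫ v)
    obtain ⟨w, hw⟩ := (h _).2 (u', v')
    obtain ⟨h₁, h₂⟩ := Prod.mk.injEq .. ▸ hw
    refine ⟨inv (adj.counit.app t) ≫ L.map w, Prod.ext ?_ ?_⟩
    · simp [← Functor.map_comp, h₁, hu]
    · simp [← Functor.map_comp, h₂, hv]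

end Adjunction

section

variable {A : Type u₁} [Category.{v₁} A]

theorem IsPullback.isIso_iff_isPullback {p q x y z : A} {a : p ⟶ x} {b : p ⟶ y} {f : x ⟶ z}
    {g : y ⟶ z} (h : IsPullback a b f g) {u : q ⟶ p} {a' : q ⟶ x} {b' : q ⟶ y}
    (ha : u ≫ a = a') (hb : u ≫ b = b') : IsIso u ↔ IsPullback a' b' f g := by
  subst ha hb
  constructor
  · intro
    exact IsPullback.of_iso h (asIso u).symm (Iso.refl _) (Iso.refl _)
      (Iso.refl _) (by simp) (by simp) (by simp) (by simp)
  · intro h'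
    have : u = (h'.isoIsPullback _ _ h).hom := by
      apply h.hom_ext <;> simp
    rw [this]
    infer_instance

/-- A square over `X` is a pullback if and only if it is a binary product in the slice. -/
theorem Over.isPullback_iff_bijective {X : A} {a b p : Over X} {p₁ : p ⟶ a} {p₂ : p ⟶ b} :
    IsPullback p₁.left p₂.left a.hom b.hom ↔
      ∀ t : Over X, Function.Bijective fun w : t ⟶ p => (w ≫ p₁, w ≫ p₂) := by
  constructor
  · intro h t
    constructor
    · intro w w' hw
      obtain ⟨h₁, h₂⟩ := Prod.mk.injEq .. ▸ hw
      exact Over.OverMorphism.ext (h.hom_ext (congrArg (fun k => k.left) h₁)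
        (congrArg (fun k => k.left) h₂))
    · rintro ⟨u, v⟩
      exact ⟨Over.homMk (h.lift u.left v.left (by simp))
        (by rw [← Over.w p₁, h.lift_fst_assoc, Over.w]),
        Prod.ext (Over.OverMorphism.ext (h.lift_fst _ _ _))
          (Over.OverMorphism.ext (h.lift_snd _ _ _))⟩
  · intro h
    -- Any arrow into `p.left` makes its source an object over X, so testing in the slice loses
    -- nothing.
    have hom_ext : ∀ {t : A} (m m' : t ⟶ p.left), m ≫ p₁.left = m' ≫ p₁.left →
        m ≫ p₂.left = m' ≫ p₂.left → m = m' := by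
      intro t m m' h₁ h₂
      have : (Over.homMk m : Over.mk (m ≫ p.hom) ⟶ p) = Over.homMk m'
          (by rw [← Over.w p₁, ← reassoc_of% h₁]; simp) :=
        (h _).1 (Prod.ext (Over.OverMorphism.ext h₁) (Over.OverMorphism.ext h₂))
      exact congrArg (fun k => k.left) this
    choose l hl using fun (t : A) (u : t ⟶ a.left) (v : t ⟶ b.left) (w : u ≫ a.hom = v ≫ b.hom) =>
      (h (Over.mk (u ≫ a.hom))).2 (Over.homMk u, Over.homMk v w.symm)
    have hl₁ := fun t u v w => congrArg (fun k => k.1.left) (hl t u v w)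
    have hl₂ := fun t u v w => congrArg (fun k => k.2.left) (hl t u v w)
    exact ⟨⟨by simp⟩, ⟨PullbackCone.IsLimit.mk _ (fun s => (l _ s.fst s.snd s.condition).left)
      (fun s => hl₁ _ _ _ s.condition) (fun s => hl₂ _ _ _ s.condition)
      (fun s m h₁ h₂ => hom_ext _ _ (h₁.trans (hl₁ _ _ _ s.condition).symm)
        (h₂.trans (hl₂ _ _ _ s.condition).symm))⟩⟩

end

end CategoryTheory

/-! ### Trivial objects over X -/

namespace Janelidze

variable {A : Type u₁} [Category.{v₁} A] {P : Type u₂} [Category.{v₂} P] [HasPullbacks A]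
  {S : A ⥤ P} {C : P ⥤ A}

theorem sliceAdj_unit_app_left_fst (adj : S ⊣ C) {X : A} (a : Over X) :
    ((sliceAdj adj X).unit.app a).left ≫ pullback.fst (C.map (S.map a.hom)) (adj.unit.app X) =
      adj.unit.app a.left := by
  simp [sliceAdj]
  erw [Category.assoc, Category.assoc, pullback.lift_fst, pullback.lift_fst,
    pullback.lift_fst_assoc, Category.id_comp]

theorem sliceAdj_unit_app_left_snd (adj : S ⊣ C) {X : A} (a : Over X) :
    ((sliceAdj adj X).unit.app a).left ≫ pullback.snd (C.map (S.map a.hom)) (adj.unit.app X) =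
      a.hom :=
  Over.w ((sliceAdj adj X).unit.app a)

theorem sliceAdj_counit_app_left (adj : S ⊣ C) {X : A} (E : Over (S.obj X)) :
    ((sliceAdj adj X).counit.app E).left =
      S.map (pullback.fst (C.map E.hom) (adj.unit.app X)) ≫ adj.counit.app E.left := by
  simp [sliceAdj]
  rfl

/-- The objects over `X` at which the unit of `S_X ⊣ C_X` is an isomorphism. -/
def IsTrivial (adj : S ⊣ C) (X : A) : ObjectProperty (Over X) := fun a =>
  IsIso ((sliceAdj adj X).unit.app a)

/-- The unit of the slice adjunction is the comparison with the chosen pullback. The right-hand side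
is free of that choice, so it can be transported to underlying objects. -/
theorem isTrivial_iff_isPullback (adj : S ⊣ C) {X : A} (a : Over X) :
    IsTrivial adj X a ↔
      IsPullback (adj.unit.app a.left) a.hom (C.map (S.map a.hom)) (adj.unit.app X) := by
  have key := IsPullback.of_hasPullback (C.map (S.map a.hom)) (adj.unit.app X)
  refine Iff.trans ⟨fun h => ?_, fun h => ?_⟩
    (key.isIso_iff_isPullback (sliceAdj_unit_app_left_fst adj a)
      (sliceAdj_unit_app_left_snd adj a))
  · have : IsIso ((sliceAdj adj X).unit.app a) := h
    exact (Over.forget X).map_isIso ((sliceAdj adj X).unit.app a)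
  · have : IsIso ((Over.forget X).map ((sliceAdj adj X).unit.app a)) := h
    exact isIso_of_reflects_iso _ (Over.forget X)

instance (adj : S ⊣ C) (X : A) : (IsTrivial adj X).IsClosedUnderIsomorphisms where
  of_iso e h := (NatTrans.isIso_app_iff_of_iso _ e).1 h

/-- The slice functor `S_X` preserves products of trivial objects. -/
theorem IsTrivial.isPullback_map {adj : S ⊣ C} {X : A} (hε : IsIso (sliceAdj adj X).counit)
    {a b p : Over X} (ha : IsTrivial adj X a) (hb : IsTrivial adj X b) {p₁ : p ⟶ a} {p₂ : p ⟶ b}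
    (h : IsPullback p₁.left p₂.left a.hom b.hom) :
    IsPullback (S.map p₁.left) (S.map p₂.left) (S.map a.hom) (S.map b.hom) :=
  Over.isPullback_iff_bijective.2 ((sliceAdj adj X).bijective_map_of_isIso_unit hε ha hb
    (Over.isPullback_iff_bijective.1 h))

end Janelidze

/-! ### Kernel pair actions as algebras for the monad f^*f_! -/

namespace Janelidze

attribute [local simp] pullback.lift_fst pullback.lift_fst_assoc pullback.lift_snd
  pullback.lift_snd_assoc

section KernelPair

variable {A : Type u₁} [Category.{v₁} A] [HasPullbacks A] {X Y : A} (f : X ⟶ Y)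

@[simp]
theorem kernelPairData_m_fst :
    (kernelPairData f).m ≫ pullback.fst f f = pullback.fst _ _ ≫ pullback.fst f f :=
  pullback.lift_fst _ _ _

@[simp]
theorem kernelPairData_m_snd :
    (kernelPairData f).m ≫ pullback.snd f f = pullback.snd _ _ ≫ pullback.snd f f :=
  pullback.lift_snd _ _ _

/-- The map `(x, y, b) ↦ (x, y, v b)` induced by a morphism `v` over `X`. -/
noncomputable def kernelPairMap {B B' : A} {b : B ⟶ X} {b' : B' ⟶ X} (v : B ⟶ B')
    (w : v ≫ b' = b) :
    pullback (pullback.snd f f) b ⟶ pullback (pullback.snd f f) b' :=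
  pullback.lift (pullback.fst _ _) (pullback.snd _ _ ≫ v)
    (by rw [Category.assoc, w, pullback.condition])

@[simp]
theorem kernelPairMap_fst {B B' : A} {b : B ⟶ X} {b' : B' ⟶ X} (v : B ⟶ B') (w : v ≫ b' = b) :
    kernelPairMap f v w ≫ pullback.fst _ _ = pullback.fst _ _ :=
  pullback.lift_fst _ _ _

@[simp]
theorem kernelPairMap_snd {B B' : A} {b : B ⟶ X} {b' : B' ⟶ X} (v : B ⟶ B') (w : v ≫ b' = b) :
    kernelPairMap f v w ≫ pullback.snd _ _ = pullback.snd _ _ ≫ v :=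
  pullback.lift_snd _ _ _

theorem kernelPairMap_comp {B B' B'' : A} {b : B ⟶ X} {b' : B' ⟶ X} {b'' : B'' ⟶ X} (v : B ⟶ B')
    (w : v ≫ b' = b) (v' : B' ⟶ B'') (w' : v' ≫ b'' = b') :
    kernelPairMap f (v ≫ v') (by rw [Category.assoc, w', w]) =
      kernelPairMap f v w ≫ kernelPairMap f v' w' := by
  apply pullback.hom_ext
  · simp
  · simp [kernelPairMap]

@[simp]
theorem kernelPairAct_fst (a : Over Y) :
    kernelPairAct f a ≫ pullback.fst a.hom f = pullback.snd _ _ ≫ pullback.fst a.hom f :=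
  pullback.lift_fst _ _ _

@[simp]
theorem kernelPairAct_snd (a : Over Y) :
    kernelPairAct f a ≫ pullback.snd a.hom f = pullback.fst _ _ ≫ pullback.fst f f :=
  pullback.lift_snd _ _ _

/-- An action of the kernel pair groupoid of `f` on an object `b` over `X`, given by the morphism
`ν : X ×_Y B ⟶ B`. Associativity is stated at the universal composable triple. -/
structure IsKernelPairAction {B : A} (b : B ⟶ X) (ν : pullback (pullback.snd f f) b ⟶ B) :
    Prop where
  act_hom : ν ≫ b = pullback.fst _ _ ≫ pullback.fst f f
  one_act : pullback.lift (b ≫ pullback.lift (𝟙 X) (𝟙 X) rfl) (𝟙 B) (by simp) ≫ ν = 𝟙 B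
  comp_act :
    pullback.lift (f := pullback.snd f f) (g := b)
        (pullback.lift (pullback.fst (pullback.snd f f) (pullback.fst (pullback.snd f f) b ≫
          pullback.fst f f)) (pullback.snd _ _ ≫ pullback.fst _ _)
          (by simp [pullback.condition]) ≫ (kernelPairData f).m)
        (pullback.snd _ _ ≫ pullback.snd _ _) (by simp [pullback.condition]) ≫ ν =
      kernelPairMap f ν act_hom ≫ ν

/-- The comparison `(b, x) ↦ ((x, b), b)` from `X ×_Y B` to the domain of an action. -/
noncomputable def toKernelPair {B : A} (b : B ⟶ X) :
    pullback (b ≫ f) f ⟶ pullback (pullback.snd f f) b :=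
  pullback.lift (pullback.lift (pullback.snd _ _) (pullback.fst _ _ ≫ b)
    (by simp [pullback.condition])) (pullback.fst _ _) (by simp)

@[simp]
theorem toKernelPair_fst {B : A} (b : B ⟶ X) :
    toKernelPair f b ≫ pullback.fst _ _ = pullback.lift (pullback.snd _ _) (pullback.fst _ _ ≫ b)
      (by simp [pullback.condition]) :=
  pullback.lift_fst _ _ _

@[simp]
theorem toKernelPair_snd {B : A} (b : B ⟶ X) :
    toKernelPair f b ≫ pullback.snd _ _ = pullback.fst _ _ :=
  pullback.lift_snd _ _ _

theorem toKernelPair_fst_fst {B : A} (b : B ⟶ X) :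
    toKernelPair f b ≫ pullback.fst _ _ ≫ pullback.fst f f = pullback.snd _ _ := by
  rw [← Category.assoc, toKernelPair_fst, pullback.lift_fst]

theorem toKernelPair_fst_snd {B : A} (b : B ⟶ X) :
    toKernelPair f b ≫ pullback.fst _ _ ≫ pullback.snd f f = pullback.fst _ _ ≫ b := by
  rw [← Category.assoc, toKernelPair_fst, pullback.lift_snd]

/-- The domain of an action on `b` is the pullback of `f_! b` along `f`. -/
theorem isPullback_kernelPair {B : A} (b : B ⟶ X) :
    IsPullback (pullback.snd (pullback.snd f f) b) (pullback.fst (pullback.snd f f) b ≫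
      pullback.fst f f) (b ≫ f) f :=
  (IsPullback.of_hasPullback (pullback.snd f f) b).flip.paste_vert
    (IsPullback.of_hasPullback f f).flip

/-- Both objects are X ×_Y B; a section is enough, since the comparison is only cancelled as an
epimorphism. -/
instance {B : A} (b : B ⟶ X) : Epi (toKernelPair f b) := by
  have h : pullback.lift (pullback.snd _ _) (pullback.fst _ _ ≫ pullback.fst f f)
      (isPullback_kernelPair f b).w ≫ toKernelPair f b = 𝟙 _ := by
    apply pullback.hom_ext
    · rw [Category.assoc, toKernelPair_fst]
      apply pullback.hom_ext <;> simp [pullback.condition]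
    · rw [Category.assoc, toKernelPair_snd]
      simp
  exact epi_of_epi_fac h

theorem mapPullbackAdj_counit_left (a : Over Y) :
    ((Over.mapPullbackAdj f).counit.app a).left = pullback.fst a.hom f := by
  simp

theorem mapPullbackAdj_unit_left (b : Over X) :
    ((Over.mapPullbackAdj f).unit.app b).left =
      pullback.lift (f := b.hom ≫ f) (𝟙 b.left) b.hom (by simp) := by
  simp

theorem toKernelPair_comp_kernelPairAct (a : Over Y) :
    toKernelPair f (pullback.snd a.hom f) ≫ kernelPairAct f a =
      pullback.lift (pullback.fst _ _ ≫ pullback.fst a.hom f) (pullback.snd _ _)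
        (by simp [pullback.condition]) := by
  apply pullback.hom_ext
  · rw [Category.assoc, kernelPairAct_fst]
    simp [← Category.assoc]
  · rw [Category.assoc, kernelPairAct_snd]
    simp [← Category.assoc]

theorem toKernelPair_comp_kernelPairMap {B B' : A} {b : B ⟶ X} {b' : B' ⟶ X} (v : B ⟶ B')
    (w : v ≫ b' = b) :
    toKernelPair f b ≫ kernelPairMap f v w =
      pullback.lift (pullback.fst _ _ ≫ v) (pullback.snd _ _)
        (by rw [Category.assoc, reassoc_of% w, pullback.condition]) ≫ toKernelPair f b' := by
  apply pullback.hom_ext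
  · rw [Category.assoc, kernelPairMap_fst, Category.assoc, toKernelPair_fst, toKernelPair_fst]
    apply pullback.hom_ext <;> simp [w]
  · rw [Category.assoc, kernelPairMap_snd, Category.assoc, toKernelPair_snd]
    simp [← Category.assoc]

/-- The structure of an algebra for the monad `f^* f_!` underlying an action of the kernel pair
groupoid. -/
noncomputable def kernelPairAlgebra {B : A} {b : B ⟶ X} {ν : pullback (pullback.snd f f) b ⟶ B}
    (h : IsKernelPairAction f b ν) : (Over.mapPullbackAdj f).toMonad.Algebra where
  A := Over.mk b
  a := Over.homMk (U := Over.mk (pullback.snd (b ≫ f) f)) (toKernelPair f b ≫ ν) (by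
    change (toKernelPair f b ≫ ν) ≫ b = pullback.snd (b ≫ f) f
    rw [Category.assoc, h.act_hom, toKernelPair_fst_fst])
  unit := by
    apply Over.OverMorphism.ext
    change ((Over.mapPullbackAdj f).unit.app (Over.mk b)).left ≫ toKernelPair f b ≫ ν = 𝟙 B
    rw [mapPullbackAdj_unit_left, ← h.one_act, ← Category.assoc]
    congr 1
    apply pullback.hom_ext
    · change (pullback.lift (f := b ≫ f) (𝟙 B) b _ ≫ toKernelPair f b) ≫ _ = _
      rw [Category.assoc, toKernelPair_fst, pullback.lift_fst]
      apply pullback.hom_ext <;> simp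
    · change (pullback.lift (f := b ≫ f) (𝟙 B) b _ ≫ toKernelPair f b) ≫ _ = _
      rw [Category.assoc, toKernelPair_snd, pullback.lift_fst, pullback.lift_snd]
  assoc := by
    apply Over.OverMorphism.ext
    change pullback.lift (f := b ≫ f) (g := f)
        (pullback.fst (pullback.snd (b ≫ f) f ≫ f) f ≫
          ((Over.mapPullbackAdj f).counit.app (Over.mk (b ≫ f))).left)
        (pullback.snd (pullback.snd (b ≫ f) f ≫ f) f) _ ≫ toKernelPair f b ≫ ν =
      pullback.lift (f := b ≫ f) (g := f)
        (pullback.fst (pullback.snd (b ≫ f) f ≫ f) f ≫ (toKernelPair f b ≫ ν))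
        (pullback.snd (pullback.snd (b ≫ f) f ≫ f) f) _ ≫ toKernelPair f b ≫ ν
    have w : toKernelPair f b ≫ pullback.fst _ _ ≫ pullback.fst f f = pullback.snd _ _ :=
      toKernelPair_fst_fst f b
    have w' : (toKernelPair f b ≫ ν) ≫ b = pullback.snd _ _ := by
      rw [Category.assoc, h.act_hom, w]
    -- This factors the right-hand side through the universal triple X ×_Y X ×_Y B, where the action
    -- law `h.comp_act` applies; the rest is a comparison of coordinates.
    have e := toKernelPair_comp_kernelPairMap f _ w'
    rw [kernelPairMap_comp f _ w _ h.act_hom] at e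
    rw [← Category.assoc, ← Category.assoc, ← e, Category.assoc, Category.assoc, Category.assoc,
      ← h.comp_act, ← Category.assoc, ← Category.assoc (kernelPairMap f _ _),
      ← Category.assoc (toKernelPair f _)]
    congr 1
    simp only [mapPullbackAdj_counit_left]
    apply pullback.hom_ext
    · apply pullback.hom_ext
      · simp only [Category.assoc, pullback.lift_fst, pullback.lift_snd,
          toKernelPair_fst, pullback.lift_fst_assoc]
        rw [reassoc_of% (kernelPairMap_fst f (toKernelPair f b) w), toKernelPair_fst_fst]
      · simp only [Category.assoc, pullback.lift_fst, pullback.lift_snd,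
          toKernelPair_fst, pullback.lift_fst_assoc, pullback.lift_snd_assoc]
        rw [reassoc_of% (kernelPairMap_snd f (toKernelPair f b) w), toKernelPair_fst_snd,
          reassoc_of% (toKernelPair_snd f (pullback.snd (b ≫ f) f))]
        rfl
    · simp only [Category.assoc, pullback.lift_fst, pullback.lift_snd, toKernelPair_snd]
      rw [reassoc_of% (kernelPairMap_snd f (toKernelPair f b) w), toKernelPair_snd,
        reassoc_of% (toKernelPair_snd f (pullback.snd (b ≫ f) f))]
      rfl

/-- The structure map of the algebra associated to `a` by the comparison functor. -/
theorem toKernelPair_comp_kernelPairAct_eq (a : Over Y) :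
    toKernelPair f (pullback.snd a.hom f) ≫ kernelPairAct f a =
      ((Over.pullback f).map ((Over.mapPullbackAdj f).counit.app a)).left := by
  rw [toKernelPair_comp_kernelPairAct]
  change _ = pullback.lift (f := a.hom) (g := f)
    (pullback.fst (pullback.snd a.hom f ≫ f) f ≫ ((Over.mapPullbackAdj f).counit.app a).left)
    (pullback.snd (pullback.snd a.hom f ≫ f) f) _
  simp only [mapPullbackAdj_counit_left]

/-- Descent of objects: essential surjectivity of the comparison functor, with an isomorphism of
algebras read as an equivariant map. -/
theorem exists_of_kernelPairAction
    (hK : (Monad.comparison (Over.mapPullbackAdj f)).IsEquivalence) {B : A} {b : B ⟶ X}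
    {ν : pullback (pullback.snd f f) b ⟶ B} (h : IsKernelPairAction f b ν) :
    ∃ (a : Over Y) (i : pullback a.hom f ≅ B) (w : i.hom ≫ b = pullback.snd a.hom f),
      kernelPairAct f a ≫ i.hom = kernelPairMap f i.hom w ≫ ν := by
  obtain ⟨a, ⟨i⟩⟩ := hK.essSurj.mem_essImage (kernelPairAlgebra f h)
  refine ⟨a, ((Over.mapPullbackAdj f).toMonad.forget ⋙ Over.forget X).mapIso i,
    Over.w i.hom.f, ?_⟩
  rw [← cancel_epi (toKernelPair f (pullback.snd a.hom f)), ← Category.assoc,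
    toKernelPair_comp_kernelPairAct_eq, ← Category.assoc]
  have e := congrArg (fun k => k.left) i.hom.h.symm
  refine e.trans (((Category.assoc _ _ _).symm).trans (congrArg (fun k => k ≫ ν) ?_))
  exact (toKernelPair_comp_kernelPairMap f i.hom.f.left (Over.w i.hom.f)).symm

/-- Descent of morphisms: equivariance is the condition for a morphism of algebras, and the
comparison functor is full. -/
theorem exists_map_of_kernelPairMap_comm
    (hK : (Monad.comparison (Over.mapPullbackAdj f)).IsEquivalence) {a a' : Over Y}
    (v : (Over.pullback f).obj a ⟶ (Over.pullback f).obj a')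
    (h : kernelPairAct f a ≫ v.left = kernelPairMap f v.left (Over.w v) ≫ kernelPairAct f a') :
    ∃ w : a ⟶ a', (Over.pullback f).map w = v := by
  obtain ⟨w, hw⟩ := hK.full.map_surjective (X := a) (Y := a')
    ⟨v, by
      apply Over.OverMorphism.ext
      change pullback.lift (f := pullback.snd a'.hom f ≫ f) (g := f)
        (pullback.fst (pullback.snd a.hom f ≫ f) f ≫ v.left)
        (pullback.snd (pullback.snd a.hom f ≫ f) f) _ ≫
          ((Over.pullback f).map ((Over.mapPullbackAdj f).counit.app a')).left =
        ((Over.pullback f).map ((Over.mapPullbackAdj f).counit.app a)).left ≫ v.left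
      rw [← toKernelPair_comp_kernelPairAct_eq, ← toKernelPair_comp_kernelPairAct_eq,
        Category.assoc, h, ← Category.assoc, ← Category.assoc]
      exact congrArg (fun k => k ≫ kernelPairAct f a')
        (toKernelPair_comp_kernelPairMap f v.left (Over.w v)).symm⟩
  exact ⟨w, congrArg (fun k => k.f) hw⟩

theorem pullback_map_injective
    (hK : (Monad.comparison (Over.mapPullbackAdj f)).IsEquivalence) {a a' : Over Y} {v w : a ⟶ a'}
    (h : (Over.pullback f).map v = (Over.pullback f).map w) : v = w :=
  hK.faithful.map_injective (Monad.Algebra.Hom.ext h)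

end KernelPair

end Janelidze

/-! ### The Galois groupoid -/

namespace Janelidze

attribute [local simp] pullback.lift_fst pullback.lift_fst_assoc pullback.lift_snd
  pullback.lift_snd_assoc

section

variable {A : Type u₁} [Category.{v₁} A] [HasPullbacks A] {X Y : A} (f : X ⟶ Y)

theorem isKernelPairAction_kernelPairAct (a : Over Y) :
    IsKernelPairAction f (pullback.snd a.hom f) (kernelPairAct f a) where
  act_hom := kernelPairAct_snd f a
  one_act := by
    apply pullback.hom_ext
    · rw [Category.assoc, kernelPairAct_fst]
      simp
    · rw [Category.assoc, kernelPairAct_snd]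
      simp
  comp_act := by
    apply pullback.hom_ext
    · rw [Category.assoc, Category.assoc (kernelPairMap f _ _), kernelPairAct_fst,
        reassoc_of% (kernelPairMap_snd f (kernelPairAct f a) (kernelPairAct_snd f a)),
        kernelPairAct_fst]
      simp
    · rw [Category.assoc, Category.assoc (kernelPairMap f _ _), kernelPairAct_snd,
        reassoc_of% (kernelPairMap_fst f (kernelPairAct f a) (kernelPairAct_snd f a))]
      simp

/-- The groupoid acts on its own arrows, so the left unit law and associativity of Gal[f] are
instances of action laws. -/
theorem isKernelPairAction_m :
    IsKernelPairAction f (pullback.fst f f) (kernelPairData f).m where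
  act_hom := kernelPairData_m_fst f
  one_act := by
    apply pullback.hom_ext
    · rw [Category.assoc, kernelPairData_m_fst]
      simp
    · rw [Category.assoc, kernelPairData_m_snd]
      simp
  comp_act := by
    apply pullback.hom_ext
    · rw [Category.assoc, Category.assoc (kernelPairMap f _ _), kernelPairData_m_fst,
        reassoc_of% (kernelPairMap_fst f (kernelPairData f).m (kernelPairData_m_fst f))]
      simp
    · have e : (kernelPairMap f (kernelPairData f).m (kernelPairData_m_fst f) ≫
          (kernelPairData f).m) ≫ pullback.snd f f = pullback.snd _ _ ≫ pullback.snd _ _ ≫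
            pullback.snd f f := by
        rw [Category.assoc, kernelPairData_m_snd,
          reassoc_of% (kernelPairMap_snd f (kernelPairData f).m (kernelPairData_m_fst f)),
          kernelPairData_m_snd]
      rw [e]
      simp

end

variable {A : Type u₁} [Category.{v₁} A] {P : Type u₂} [Category.{v₂} P] [HasPullbacks A]
  {S : A ⥤ P} {C : P ⥤ A} {adj : S ⊣ C} {X Y : A} {f : X ⟶ Y}

theorem isTrivial_mk_id : IsTrivial adj X (Over.mk (𝟙 X)) := by
  rw [isTrivial_iff_isPullback]
  have h : ∀ {Z : A} (u : X ⟶ Z) (v : Z ⟶ Z), v = 𝟙 Z → IsPullback u (𝟙 X) v u := by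
    rintro Z u _ rfl
    exact IsPullback.of_vert_isIso ⟨by simp⟩
  exact h _ _ (by simp)

namespace IsRelativeGaloisDescent

/-- A trivial b is isomorphic to C_X S_X b, to which condition (3) applies. -/
theorem isTrivial_pullback_map (hf : IsRelativeGaloisDescent adj f)
    {b : Over X} (hb : IsTrivial adj X b) :
    IsTrivial adj X ((Over.pullback f).obj ((Over.map f).obj b)) := by
  have : IsIso ((sliceAdj adj X).unit.app b) := hb
  exact (IsTrivial adj X).prop_of_iso ((Over.map f ⋙ Over.pullback f).mapIso
    (asIso ((sliceAdj adj X).unit.app b)).symm) (hf.isSplit ((sliceS S X).obj b))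

theorem isTrivial_kernelPair (hf : IsRelativeGaloisDescent adj f)
    {B : A} {b : B ⟶ X} (hb : IsTrivial adj X (Over.mk b)) :
    IsTrivial adj X (Over.mk (pullback.fst (pullback.snd f f) b ≫ pullback.fst f f)) :=
  (IsTrivial adj X).prop_of_iso (Over.isoMk (isPullback_kernelPair f b).isoPullback.symm
    (by simp)) (hf.isTrivial_pullback_map hb)

/-- The object f over Y is f_! of the identity of X, and the identity is trivial. -/
theorem isTrivial_snd (hf : IsRelativeGaloisDescent adj f)
    : IsTrivial adj X (Over.mk (pullback.snd f f)) :=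
  (IsTrivial adj X).prop_of_iso ((Over.pullback f).mapIso
    (Over.isoMk (Iso.refl X) : (Over.map f).obj (Over.mk (𝟙 X)) ≅ Over.mk f))
      (hf.isTrivial_pullback_map isTrivial_mk_id)

theorem isTrivial_fst (hf : IsRelativeGaloisDescent adj f)
    : IsTrivial adj X (Over.mk (pullback.fst f f)) :=
  (IsTrivial adj X).prop_of_iso (Over.isoMk (pullbackSymmetry f f)) hf.isTrivial_snd

/-- The functor `S` preserves the pullback of a trivial object over `X` along the source map of the
kernel pair groupoid. -/
theorem isPullback_map (hf : IsRelativeGaloisDescent adj f)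
    {B : A} {b : B ⟶ X} (hb : IsTrivial adj X (Over.mk b)) :
    IsPullback (S.map (pullback.fst (pullback.snd f f) b))
      (S.map (pullback.snd (pullback.snd f f) b))
      (S.map (pullback.snd f f)) (S.map b) :=
  IsTrivial.isPullback_map hf.isIso_counit hf.isTrivial_snd hb
    (p := Over.mk (pullback.fst (pullback.snd f f) b ≫ pullback.snd f f))
    (p₁ := Over.homMk (pullback.fst _ _)) (p₂ := Over.homMk (pullback.snd _ _)
      pullback.condition.symm) (IsPullback.of_hasPullback _ _)

/-- T need not be in the image of S. However, S preserves the pullback defining the universal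
composable triple, because the domain of the action is again trivial; so every triple factors
through the image of the universal one. -/
theorem map_comp_act (hf : IsRelativeGaloisDescent adj f)
    {B : A} {b : B ⟶ X} (hb : IsTrivial adj X (Over.mk b))
    {ν : pullback (pullback.snd f f) b ⟶ B} (h : IsKernelPairAction f b ν) {T : P}
    (g₁ g₂ : T ⟶ S.obj (pullback f f)) (a : T ⟶ S.obj B)
    (h₁₂ : g₁ ≫ S.map (pullback.snd f f) = g₂ ≫ S.map (pullback.fst f f))
    (h₂ : g₂ ≫ S.map (pullback.snd f f) = a ≫ S.map b) :
    (hf.isPullback_map hb).lift ((hf.isPullback_map hf.isTrivial_fst).lift g₁ g₂ h₁₂ ≫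
        S.map (kernelPairData f).m) a (by
          rw [Category.assoc, ← S.map_comp, kernelPairData_m_snd, S.map_comp,
            IsPullback.lift_snd_assoc, h₂]) ≫ S.map ν =
      (hf.isPullback_map hb).lift g₁ ((hf.isPullback_map hb).lift g₂ a h₂ ≫ S.map ν) (by
        rw [Category.assoc, ← S.map_comp, h.act_hom, S.map_comp, IsPullback.lift_fst_assoc, h₁₂])
          ≫ S.map ν := by
  have hQ := hf.isPullback_map hb
  have hQ' := hf.isPullback_map (hf.isTrivial_kernelPair hb)
  have hC := hf.isPullback_map hf.isTrivial_fst
  -- Here w is the pair (g₂, a) and z the triple (g₁, g₂, a).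
  obtain ⟨w, hw₁, hw₂⟩ := hQ.exists_lift g₂ a h₂
  obtain ⟨z, hz₁, hz₂⟩ := hQ'.exists_lift g₁ w (by
    rw [S.map_comp, reassoc_of% hw₁, h₁₂])
  have e := ((congrArg (fun k => z ≫ k) (S.map_comp _ _)).symm.trans
    (congrArg (fun k => z ≫ S.map k) h.comp_act)).trans (congrArg (fun k => z ≫ k) (S.map_comp _ _))
  refine Eq.trans (congrArg (fun k => k ≫ S.map ν) ?_) (((Category.assoc _ _ _).trans e).trans
    ((Category.assoc _ _ _).symm.trans (congrArg (fun k => k ≫ S.map ν) ?_)))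
  · apply hQ.hom_ext
    · rw [hQ.lift_fst, Category.assoc, ← S.map_comp, pullback.lift_fst, S.map_comp,
        ← Category.assoc]
      congr 1
      apply hC.hom_ext
      · rw [hC.lift_fst, Category.assoc, ← S.map_comp, pullback.lift_fst, hz₁]
      · rw [hC.lift_snd, Category.assoc, ← S.map_comp, pullback.lift_snd, S.map_comp,
          reassoc_of% hz₂, hw₁]
    · rw [hQ.lift_snd, Category.assoc, ← S.map_comp, pullback.lift_snd, S.map_comp,
        reassoc_of% hz₂, hw₂]
  · apply hQ.hom_ext
    · rw [hQ.lift_fst, Category.assoc, ← S.map_comp, kernelPairMap_fst, hz₁]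
    · rw [hQ.lift_snd, Category.assoc, ← S.map_comp, kernelPairMap_snd, S.map_comp,
        reassoc_of% hz₂]
      congr 1
      apply hQ.hom_ext
      · rw [hw₁, hQ.lift_fst]
      · rw [hw₂, hQ.lift_snd]

/-- The primed arrows are variables so that components equal to images under S only propositionally,
such as identities, are allowed. -/
theorem lift_comp_map (hf : IsRelativeGaloisDescent adj f)
    {B : A} {b : B ⟶ X} (hb : IsTrivial adj X (Over.mk b))
    {ν : pullback (pullback.snd f f) b ⟶ B} {T : A} (u : T ⟶ pullback f f) (v : T ⟶ B)
    (w : u ≫ pullback.snd f f = v ≫ b) (u' : S.obj T ⟶ S.obj (pullback f f))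
    (v' : S.obj T ⟶ S.obj B) (hu : u' = S.map u) (hv : v' = S.map v)
    (w' : u' ≫ S.map (pullback.snd f f) = v' ≫ S.map b) :
    (hf.isPullback_map hb).lift u' v' w' ≫ S.map ν = S.map (pullback.lift u v w ≫ ν) := by
  subst hu hv
  rw [S.map_comp]
  congr 1
  apply (hf.isPullback_map hb).hom_ext
  · rw [IsPullback.lift_fst, ← S.map_comp, pullback.lift_fst]
  · rw [IsPullback.lift_snd, ← S.map_comp, pullback.lift_snd]

theorem map_one_act (hf : IsRelativeGaloisDescent adj f)
    {B : A} {b : B ⟶ X} (hb : IsTrivial adj X (Over.mk b))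
    {ν : pullback (pullback.snd f f) b ⟶ B} (h : IsKernelPairAction f b ν) :
    (hf.isPullback_map hb).lift (S.map b ≫ S.map (pullback.lift (𝟙 X) (𝟙 X) rfl)) (𝟙 (S.obj B))
      (by rw [Category.assoc, ← S.map_comp, ← S.map_comp]; simp) ≫ S.map ν = 𝟙 (S.obj B) := by
  refine Eq.trans (congrArg (fun k => k ≫ S.map ν) ?_)
    (((S.map_comp _ _).symm.trans (congrArg (fun k => S.map k) h.one_act)).trans (S.map_id B))
  apply (hf.isPullback_map hb).hom_ext
  · rw [IsPullback.lift_fst, ← S.map_comp, ← S.map_comp, pullback.lift_fst]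
  · rw [IsPullback.lift_snd, ← S.map_comp, pullback.lift_snd, S.map_id]

/-- The image under `S` of the kernel pair groupoid of `f` is a groupoid. -/
theorem isGroupoid_galData (hf : IsRelativeGaloisDescent adj f)
    : (galData S f).IsGroupoid where
  isPullback := hf.isPullback_map hf.isTrivial_fst
  e_d₀ := by simp [← S.map_comp]
  e_d₁ := by simp [← S.map_comp]
  m_d₀ := by simp only [← S.map_comp, pullback.lift_snd]
  m_d₁ := by simp only [← S.map_comp, pullback.lift_fst]
  comp_id := by
    have e : pullback.lift (f := pullback.snd f f) (g := pullback.fst f f) (𝟙 _)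
        (pullback.snd f f ≫ pullback.lift (𝟙 X) (𝟙 X) rfl) (by simp) ≫ (kernelPairData f).m =
        𝟙 _ := by
      apply pullback.hom_ext <;> simp
    refine Eq.trans ?_ ((congrArg (fun k => S.map k) e).trans (S.map_id _))
    refine hf.lift_comp_map hf.isTrivial_fst _ _ _ _ _ (S.map_id _).symm (S.map_comp _ _).symm _
  id_comp := hf.map_one_act hf.isTrivial_fst (isKernelPairAction_m f)
  assoc := hf.map_comp_act hf.isTrivial_fst (isKernelPairAction_m f)
  i_d₀ := by simp [← S.map_comp]
  i_d₁ := by simp [← S.map_comp]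
  comp_inv := by
    have e : pullback.lift (f := pullback.snd f f) (g := pullback.fst f f) (𝟙 _)
        (kernelPairData f).i (by simp) ≫ (kernelPairData f).m =
        pullback.fst f f ≫ pullback.lift (𝟙 X) (𝟙 X) rfl := by
      apply pullback.hom_ext <;> simp
    refine Eq.trans ?_ ((congrArg (fun k => S.map k) e).trans (S.map_comp _ _))
    exact hf.lift_comp_map hf.isTrivial_fst _ _ _ _ _ (S.map_id _).symm rfl _
  inv_comp := by
    have e : pullback.lift (f := pullback.snd f f) (g := pullback.fst f f) (kernelPairData f).i
        (𝟙 _) (by simp) ≫ (kernelPairData f).m =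
        pullback.snd f f ≫ pullback.lift (𝟙 X) (𝟙 X) rfl := by
      apply pullback.hom_ext <;> simp
    refine Eq.trans ?_ ((congrArg (fun k => S.map k) e).trans (S.map_comp _ _))
    exact hf.lift_comp_map hf.isTrivial_fst _ _ _ _ _ rfl (S.map_id _).symm _

end IsRelativeGaloisDescent

end Janelidze

/-! ### The fundamental theorem -/

namespace InternalAction

variable {C : Type u} [Category.{v} C] {G : InternalGroupoid C}

/-- A morphism of actions whose underlying morphism is invertible is an isomorphism. -/
theorem isIso_of_isIso_hom {F F' : InternalAction G} (f : F ⟶ F') (h : IsIso f.hom) :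
    IsIso f := by
  have w : inv f.hom ≫ F.γ = F'.γ := by rw [IsIso.inv_comp_eq, f.w]
  refine ⟨⟨inv f.hom, w, ?_⟩, Hom.ext (IsIso.hom_inv_id f.hom), Hom.ext (IsIso.inv_hom_id f.hom)⟩
  rw [← cancel_mono f.hom, Category.assoc, Category.assoc, f.comm, IsIso.inv_hom_id,
    Category.comp_id, ← Category.assoc]
  refine (Category.id_comp _).symm.trans (congrArg (fun k => k ≫ F'.μ) ?_)
  apply F'.isPullback.hom_ext <;> simp

end InternalAction

namespace Janelidze

attribute [local simp] pullback.lift_fst pullback.lift_fst_assoc pullback.lift_snd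
  pullback.lift_snd_assoc

variable {A : Type u₁} [Category.{v₁} A] {P : Type u₂} [Category.{v₂} P] [HasPullbacks A]
  {S : A ⥤ P} {C : P ⥤ A} {adj : S ⊣ C} {X Y : A} {f : X ⟶ Y}

/-- The functor `S` is faithful on morphisms over `X` into a trivial object. -/
theorem IsTrivial.map_injective {B : A} {b : B ⟶ X} (hb : IsTrivial adj X (Over.mk b)) {T : A}
    {u v : T ⟶ B} (w : u ≫ b = v ≫ b) (h : S.map u = S.map v) : u = v := by
  have := (sliceAdj adj X).left_map_injective_of_isIso_unit (Over.mk (v ≫ b)) _ hb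
    (a₁ := Over.homMk u w) (a₂ := Over.homMk v) (Over.OverMorphism.ext h)
  exact congrArg (fun k => k.left) this

/-- The functor `S` is full on morphisms over `X` into a trivial object. -/
theorem IsTrivial.exists_map_eq {B : A} {b : B ⟶ X} (hb : IsTrivial adj X (Over.mk b)) {T : A}
    {t : T ⟶ X} (u : S.obj T ⟶ S.obj B) (w : u ≫ S.map b = S.map t) :
    ∃ v : T ⟶ B, v ≫ b = t ∧ S.map v = u := by
  obtain ⟨v, hv⟩ := (sliceAdj adj X).left_map_surjective_of_isIso_unit (Over.mk t) _ hb
    (Over.homMk u w)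
  exact ⟨v.left, Over.w v, congrArg (fun k => k.left) hv⟩

theorem kernelPairMap_comp_kernelPairAct (f : X ⟶ Y) {a a' : Over Y} (u : a.left ⟶ a'.left)
    (v : pullback a.hom f ⟶ pullback a'.hom f)
    (h₁ : v ≫ pullback.fst a'.hom f = pullback.fst a.hom f ≫ u)
    (h₂ : v ≫ pullback.snd a'.hom f = pullback.snd a.hom f) :
    kernelPairMap f v h₂ ≫ kernelPairAct f a' = kernelPairAct f a ≫ v := by
  apply pullback.hom_ext
  · rw [Category.assoc, Category.assoc, h₁, kernelPairAct_fst,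
      reassoc_of% (kernelPairAct_fst f a), reassoc_of% (kernelPairMap_snd f v h₂), h₁]
  · rw [Category.assoc, Category.assoc, h₂, kernelPairAct_snd, kernelPairAct_snd,
      reassoc_of% (kernelPairMap_fst f v h₂)]

/-- If the counit is an isomorphism, every object over `S X` is the image of a trivial one. -/
theorem exists_isTrivial (hε : IsIso (sliceAdj adj X).counit) {E : P} (γ : E ⟶ S.obj X) :
    ∃ (B : A) (b : B ⟶ X) (e : S.obj B ≅ E), IsTrivial adj X (Over.mk b) ∧
      e.hom ≫ γ = S.map b :=
  ⟨_, ((sliceC adj X).obj (Over.mk γ)).hom,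
    (Over.forget _).mapIso (asIso ((sliceAdj adj X).counit.app (Over.mk γ))),
    (sliceAdj adj X).isIso_unit_app_obj hε (Over.mk γ),
    Over.w ((sliceAdj adj X).counit.app (Over.mk γ))⟩

namespace IsRelativeGaloisDescent

/-- The lift of a pair of images under `S` is the image of the map of kernel pairs. -/
theorem lift_eq_map_kernelPairMap (hf : IsRelativeGaloisDescent adj f) {B B' : A} {b : B ⟶ X}
    {b' : B' ⟶ X} (hb' : IsTrivial adj X (Over.mk b')) (v : B ⟶ B') (w : v ≫ b' = b)
    (w' : S.map (pullback.fst (pullback.snd f f) b) ≫ S.map (pullback.snd f f) =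
      (S.map (pullback.snd (pullback.snd f f) b) ≫ S.map v) ≫ S.map b') :
    (hf.isPullback_map hb').lift (S.map (pullback.fst (pullback.snd f f) b))
      (S.map (pullback.snd (pullback.snd f f) b) ≫ S.map v) w' = S.map (kernelPairMap f v w) := by
  apply (hf.isPullback_map hb').hom_ext
  · rw [IsPullback.lift_fst, ← S.map_comp, kernelPairMap_fst]
  · rw [IsPullback.lift_snd, ← S.map_comp, ← S.map_comp, kernelPairMap_snd]

/-- The Galois groupoid of a morphism of relative Galois descent. -/
noncomputable abbrev gal (hf : IsRelativeGaloisDescent adj f) : InternalGroupoid P :=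
  ⟨galData S f, hf.isGroupoid_galData⟩

/-- The action of the Galois groupoid that is the image under `S` of an action of the kernel pair
groupoid on a trivial object. -/
noncomputable def action (hf : IsRelativeGaloisDescent adj f) {B : A} {b : B ⟶ X}
    (hb : IsTrivial adj X (Over.mk b)) {ν : pullback (pullback.snd f f) b ⟶ B}
    (h : IsKernelPairAction f b ν) : InternalAction hf.gal where
  F₀ := S.obj B
  γ := S.map b
  F₁ := S.obj (pullback (pullback.snd f f) b)
  fst := S.map (pullback.fst _ _)
  snd := S.map (pullback.snd _ _)
  isPullback := hf.isPullback_map hb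
  μ := S.map ν
  μ_γ := by
    change S.map ν ≫ S.map b = S.map _ ≫ S.map (pullback.fst f f)
    rw [← S.map_comp, ← S.map_comp, h.act_hom]
  one_act := hf.map_one_act hb h
  comp_act := hf.map_comp_act hb h

/-- The functor `a ↦ S (X ×_Y A)` from the objects split by `f` to the actions of the Galois
groupoid. -/
noncomputable def toAction (hf : IsRelativeGaloisDescent adj f) :
    Split adj f ⥤ InternalAction hf.gal where
  obj a := hf.action (b := pullback.snd a.obj.hom f) a.property
    (isKernelPairAction_kernelPairAct f a.obj)
  map {a a'} u :=
    { hom := S.map ((Over.pullback f).map u.hom).left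
      w := (S.map_comp _ _).symm.trans
        (congrArg (fun k => S.map k) (Over.w ((Over.pullback f).map u.hom)))
      comm := by
        have h₁ : ((Over.pullback f).map u.hom).left ≫ pullback.fst a'.obj.hom f =
          pullback.fst a.obj.hom f ≫ u.hom.left := pullback.lift_fst _ _ _
        have h₂ : ((Over.pullback f).map u.hom).left ≫ pullback.snd a'.obj.hom f =
          pullback.snd a.obj.hom f := pullback.lift_snd _ _ _
        refine (S.map_comp _ _).symm.trans (((congrArg (fun k => S.map k)
          (kernelPairMap_comp_kernelPairAct f _ _ h₁ h₂).symm).trans (S.map_comp _ _)).trans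
            (congrArg (fun k => k ≫ _) ?_))
        exact (hf.lift_eq_map_kernelPairMap (b' := pullback.snd a'.obj.hom f) a'.property _
          h₂ _).symm }
  map_id a := by
    apply InternalAction.Hom.ext
    change S.map ((Over.pullback f).map (𝟙 a.obj)).left = 𝟙 (S.obj _)
    rw [CategoryTheory.Functor.map_id]
    exact S.map_id _
  map_comp u v := by
    apply InternalAction.Hom.ext
    change S.map ((Over.pullback f).map (u.hom ≫ v.hom)).left = S.map _ ≫ S.map _
    rw [Functor.map_comp]
    exact S.map_comp _ _

theorem isEquivalence_comparison (hf : IsRelativeGaloisDescent adj f) :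
    (Monad.comparison (Over.mapPullbackAdj f)).IsEquivalence :=
  Monad.isEquivalence_comparison_of_monadic _ hf.monadic

theorem faithful_toAction (hf : IsRelativeGaloisDescent adj f) : hf.toAction.Faithful where
  map_injective {a a' u v} h := by
    apply (IsSplit adj f).hom_ext
    apply pullback_map_injective f hf.isEquivalence_comparison
    apply Over.OverMorphism.ext
    exact IsTrivial.map_injective (b := pullback.snd a'.obj.hom f) a'.property
      ((Over.w ((Over.pullback f).map u.hom)).trans (Over.w ((Over.pullback f).map v.hom)).symm)
      (congrArg (fun k => k.hom) h)

/-- A map of actions is S v for some v over X, since its codomain comes from a trivial object.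
Faithfulness of S makes v equivariant, and v then descends to Y. -/
theorem full_toAction (hf : IsRelativeGaloisDescent adj f) : hf.toAction.Full where
  map_surjective {a a'} k := by
    have ha' : IsTrivial adj X (Over.mk (pullback.snd a'.obj.hom f)) := a'.property
    obtain ⟨v, hv, hk⟩ := ha'.exists_map_eq (t := pullback.snd a.obj.hom f) k.hom k.w
    have e : kernelPairAct f a.obj ≫ v = kernelPairMap f v hv ≫ kernelPairAct f a'.obj := by
      apply ha'.map_injective
      · rw [Category.assoc, hv, Category.assoc, kernelPairAct_snd, kernelPairAct_snd,
          reassoc_of% kernelPairMap_fst]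
      · rw [S.map_comp, S.map_comp, hk]
        refine k.comm.trans (congrArg (fun l => l ≫ _) ?_)
        refine Eq.trans ?_ (hf.lift_eq_map_kernelPairMap ha' v hv (by
          rw [← S.map_comp, ← S.map_comp, ← S.map_comp, Category.assoc, hv, pullback.condition]))
        simp only [hk]
        rfl
    obtain ⟨w, hw⟩ := exists_map_of_kernelPairMap_comm f hf.isEquivalence_comparison
      (Over.homMk v hv) e
    refine ⟨⟨w⟩, InternalAction.Hom.ext ?_⟩
    change S.map ((Over.pullback f).map w).left = k.hom
    rw [hw, ← hk]
    rfl

/-- The total object is replaced by S B with B trivial, the action is lifted to ν on B, its axioms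
are reflected by faithfulness of S, and the resulting kernel pair action descends to Y. -/
theorem essSurj_toAction (hf : IsRelativeGaloisDescent adj f) : hf.toAction.EssSurj where
  mem_essImage F := by
    obtain ⟨B, b, e, hb, he⟩ := exists_isTrivial hf.isIso_counit F.γ
    -- This w compares the image under S of the domain of the future ν with the domain of the given
    -- action.
    obtain ⟨w, hw₁, hw₂⟩ := F.isPullback.exists_lift
      (S.map (pullback.fst (pullback.snd f f) b))
      (S.map (pullback.snd (pullback.snd f f) b) ≫ e.hom)
      (by rw [Category.assoc, he, ← S.map_comp, ← S.map_comp, pullback.condition])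
    have hγ : (w ≫ F.μ ≫ e.inv) ≫ S.map b =
        S.map (pullback.fst (pullback.snd f f) b ≫ pullback.fst f f) := by
      rw [← he, Category.assoc, Category.assoc, e.inv_hom_id_assoc, F.μ_γ, reassoc_of% hw₁,
        S.map_comp]
    obtain ⟨ν, hν, hSν⟩ := hb.exists_map_eq _ hγ
    have hμ : S.map ν ≫ e.hom = w ≫ F.μ := by
      rw [hSν, Category.assoc, Category.assoc, e.inv_hom_id, Category.comp_id]
    -- Up to e, the image of ν on a pair is the given action on the image of that pair; each axiom
    -- is carried across by this.
    have lift_act : ∀ {T : A} (u : T ⟶ pullback f f) (v : T ⟶ B)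
        (huv : u ≫ pullback.snd f f = v ≫ b) (u' : S.obj T ⟶ S.obj (pullback f f))
        (v' : S.obj T ⟶ F.F₀) (_ : u' = S.map u) (_ : v' = S.map v ≫ e.hom)
        (w' : u' ≫ S.map (pullback.snd f f) = v' ≫ F.γ),
        S.map (pullback.lift u v huv ≫ ν) ≫ e.hom = F.isPullback.lift u' v' w' ≫ F.μ := by
      rintro T u v huv _ _ rfl rfl w'
      rw [S.map_comp, Category.assoc, hμ, ← Category.assoc]
      congr 1
      apply F.isPullback.hom_ext
      · rw [Category.assoc, hw₁, ← S.map_comp, pullback.lift_fst, F.isPullback.lift_fst]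
      · rw [Category.assoc, hw₂, ← S.map_comp_assoc, pullback.lift_snd, F.isPullback.lift_snd]
    have h : IsKernelPairAction f b ν :=
      { act_hom := hν
        one_act := by
          apply hb.map_injective
          · rw [Category.assoc, hν, pullback.lift_fst_assoc]
            simp
          · rw [← cancel_mono e.hom]
            refine (lift_act _ _ _ (e.hom ≫ F.γ ≫ S.map (kernelPairData f).e) e.hom
              (by rw [reassoc_of% he, S.map_comp]) (by simp) ?_).trans
                (Eq.trans ?_ ((congrArg (fun k => e.hom ≫ k) F.one_act).trans
                  ((Category.comp_id _).trans (by rw [S.map_id, Category.id_comp]))))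
            · rw [Category.assoc, Category.assoc, ← S.map_comp, pullback.lift_snd, S.map_id,
                Category.comp_id]
            · refine Eq.trans (congrArg (fun k => k ≫ F.μ) ?_) (Category.assoc _ _ _)
              apply F.isPullback.hom_ext
              · rw [F.isPullback.lift_fst, Category.assoc, F.isPullback.lift_fst]
              · rw [F.isPullback.lift_snd, Category.assoc, F.isPullback.lift_snd,
                  Category.comp_id]
        comp_act := by
          -- The associativity of F at the image of the universal composable triple.
          have key := F.comp_act (T := S.obj (pullback (pullback.snd f f)
              (pullback.fst (pullback.snd f f) b ≫ pullback.fst f f)))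
            (S.map (pullback.fst _ _)) (S.map (pullback.snd _ _ ≫ pullback.fst _ _))
            (S.map (pullback.snd _ _ ≫ pullback.snd _ _) ≫ e.hom)
            (by rw [← S.map_comp, ← S.map_comp, Category.assoc, pullback.condition])
            (by rw [← S.map_comp, Category.assoc, Category.assoc, he, ← S.map_comp,
              Category.assoc, pullback.condition])
          apply hb.map_injective
          · rw [Category.assoc, hν, pullback.lift_fst_assoc, Category.assoc, kernelPairData_m_fst,
              pullback.lift_fst_assoc, Category.assoc, hν, reassoc_of% (kernelPairMap_fst f ν hν)]
          · rw [← cancel_mono e.hom]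
            refine (lift_act _ _ _ _ _ ?_ rfl _).trans (key.trans
              (lift_act _ _ _ _ _ rfl ?_ _).symm)
            · refine Eq.trans (congrArg (fun k => k ≫ S.map (kernelPairData f).m) ?_)
                (S.map_comp _ _).symm
              apply hf.isGroupoid_galData.isPullback.hom_ext
              · rw [IsPullback.lift_fst, ← S.map_comp, pullback.lift_fst]
              · rw [IsPullback.lift_snd, ← S.map_comp, pullback.lift_snd]
            · have hμ' := congrArg (fun k => S.map (pullback.snd (pullback.snd f f)
                (pullback.fst (pullback.snd f f) b ≫ pullback.fst f f)) ≫ k) hμ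
              rw [← S.map_comp_assoc, ← Category.assoc _ w] at hμ'
              refine Eq.trans (congrArg (fun k => k ≫ F.μ) ?_) hμ'.symm
              apply F.isPullback.hom_ext
              · rw [F.isPullback.lift_fst, Category.assoc, hw₁, S.map_comp]
              · rw [F.isPullback.lift_snd, Category.assoc, hw₂, S.map_comp, Category.assoc] }
    obtain ⟨a, i, hi, hν'⟩ := exists_of_kernelPairAction f hf.isEquivalence_comparison h
    have ha : IsSplit adj f a := (IsTrivial adj X).prop_of_iso
      (Over.isoMk i hi : (Over.pullback f).obj a ≅ Over.mk b).symm hb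
    let k : hf.toAction.obj ⟨a, ha⟩ ⟶ F :=
      { hom := (S.mapIso i ≪≫ e).hom
        w := by
          refine (Category.assoc _ _ _).trans ((congrArg (fun k => _ ≫ k) he).trans ?_)
          exact (S.map_comp _ _).symm.trans (congrArg (fun k => S.map k) hi)
        comm := by
          refine (Category.assoc _ _ _).symm.trans ((congrArg (fun k => k ≫ e.hom)
            ((S.map_comp _ _).symm.trans (congrArg (fun k => S.map k) hν'))).trans
              (lift_act _ _ _ _ _ rfl ?_ _))
          rw [S.map_comp, Category.assoc]
          rfl }
    have : IsIso k := InternalAction.isIso_of_isIso_hom _ (S.mapIso i ≪≫ e).isIso_hom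
    exact ⟨⟨a, ha⟩, ⟨asIso k⟩⟩

end IsRelativeGaloisDescent

/-- The fundamental theorem of categorical Galois theory. -/
theorem IsRelativeGaloisDescent.exists_equivalence (hf : IsRelativeGaloisDescent adj f) :
    ∃ (hG : (galData S f).IsGroupoid) (Φ : Split adj f ≌ InternalAction ⟨galData S f, hG⟩)
      (θ : Φ.functor ⋙ InternalAction.toOver _ ≅
        (IsSplit adj f).ι ⋙ Over.pullback f ⋙ sliceS S X),
      ∀ a : Split adj f, IsCanonicalAction f hG a.obj (Φ.functor.obj a) (θ.app a) := by
  have := hf.faithful_toAction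
  have := hf.full_toAction
  have := hf.essSurj_toAction
  have : hf.toAction.IsEquivalence := {}
  -- Forgetting the action gives S_X f^* on the nose, so θ is the identity and the lift in
  -- `IsCanonicalAction` is an identity too.
  refine ⟨hf.isGroupoid_galData, hf.toAction.asEquivalence, Iso.refl _, fun a => ?_⟩
  change (hf.isPullback_map (b := pullback.snd a.obj.hom f) a.property).lift _ (_ ≫ 𝟙 _) _ ≫
    S.map (kernelPairAct f a.obj) ≫ 𝟙 _ = _
  refine (congrArg (fun k => _ ≫ k) (Category.comp_id _)).trans
    ((congrArg (fun k => k ≫ _) ?_).trans (Category.id_comp _))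
  have h := hf.isPullback_map (b := pullback.snd a.obj.hom f) a.property
  exact h.hom_ext ((h.lift_fst _ _ _).trans (Category.id_comp _).symm)
    (((h.lift_snd _ _ _).trans (Category.comp_id _)).trans (Category.id_comp _).symm)

end Janelidze

/-! ### Pullbacks, splitness and counits of difference objects -/

namespace DiffObj

variable {C : Type u} [Category.{v} C]

theorem isIso_iff {X Y : DiffObj C} (f : X ⟶ Y) : IsIso f ↔ IsIso f.hom := by
  constructor
  · intro
    exact (forget C).map_isIso f
  · intro h
    refine ⟨⟨inv f.hom, ?_⟩, hom_ext (IsIso.hom_inv_id f.hom), hom_ext (IsIso.inv_hom_id f.hom)⟩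
    rw [IsIso.inv_comp_eq, ← Category.assoc, IsIso.eq_comp_inv, f.comm]

/-- A square of difference objects is a pullback if the underlying square is. -/
theorem isPullback_of_hom {P X Y Z : DiffObj C} {a : P ⟶ X} {b : P ⟶ Y} {f : X ⟶ Z} {g : Y ⟶ Z}
    (h : IsPullback a.hom b.hom f.hom g.hom) : IsPullback a b f g where
  w := hom_ext h.w
  isLimit' := ⟨PullbackCone.IsLimit.mk _
    (fun s =>
      { hom := h.lift s.fst.hom s.snd.hom (congrArg Hom.hom s.condition)
        comm := h.hom_ext
          (by
            rw [Category.assoc, Category.assoc, ← a.comm, h.lift_fst_assoc, h.lift_fst]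
            exact s.fst.comm)
          (by
            rw [Category.assoc, Category.assoc, ← b.comm, h.lift_snd_assoc, h.lift_snd]
            exact s.snd.comm) })
    (fun s => hom_ext (h.lift_fst _ _ _))
    (fun s => hom_ext (h.lift_snd _ _ _))
    (fun s m h₁ h₂ => hom_ext (h.hom_ext
      ((congrArg Hom.hom h₁).trans (h.lift_fst _ _ _).symm)
      ((congrArg Hom.hom h₂).trans (h.lift_snd _ _ _).symm)))⟩

/-- A given pullback is compared with the one built on the underlying pullback; the comparison is
invertible, hence so is its underlying arrow. -/
theorem isPullback_iff [HasPullbacks C] {P X Y Z : DiffObj C} {a : P ⟶ X} {b : P ⟶ Y}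
    {f : X ⟶ Z} {g : Y ⟶ Z} : IsPullback a b f g ↔ IsPullback a.hom b.hom f.hom g.hom := by
  refine ⟨fun h => ?_, isPullback_of_hom⟩
  have hp := IsPullback.of_hasPullback f.hom g.hom
  let p : DiffObj C := ⟨pullback f.hom g.hom, hp.lift (pullback.fst _ _ ≫ X.σ)
    (pullback.snd _ _ ≫ Y.σ) (by
      rw [Category.assoc, Category.assoc, ← f.comm, ← g.comm, hp.w_assoc])⟩
  let p₁ : p ⟶ X := ⟨pullback.fst _ _, (hp.lift_fst _ _ _).symm⟩
  let p₂ : p ⟶ Y := ⟨pullback.snd _ _, (hp.lift_snd _ _ _).symm⟩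
  have hp' : IsPullback p₁ p₂ f g := isPullback_of_hom hp
  have := (hp'.isIso_iff_isPullback (hp'.lift_fst _ _ h.w) (hp'.lift_snd _ _ h.w)).2 h
  exact (hp.isIso_iff_isPullback (congrArg Hom.hom (hp'.lift_fst _ _ h.w))
    (congrArg Hom.hom (hp'.lift_snd _ _ h.w))).1 ((isIso_iff _).1 this)

end DiffObj

namespace Janelidze

variable {A : Type u₁} [Category.{v₁} A] {P : Type u₂} [Category.{v₂} P] [HasPullbacks A]
  {S : A ⥤ P} {C : P ⥤ A}

/-- Splitness can be tested on any pullback along `f`. -/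
theorem isSplit_iff_isTrivial (adj : S ⊣ C) {X Y : A} {f : X ⟶ Y} {a : Over Y} {b : Over X}
    {p : b.left ⟶ a.left} (h : IsPullback p b.hom a.hom f) :
    IsSplit adj f a ↔ IsTrivial adj X b :=
  (IsTrivial adj X).prop_iff_of_iso (Over.isoMk h.isoPullback.symm (by simp) :
    (Over.pullback f).obj a ≅ b)

/-- Whether the counit of `S_X ⊣ C_X` is an isomorphism can be tested on any pullback. -/
theorem isIso_counit_app_iff (adj : S ⊣ C) {X : A} {E : Over (S.obj X)} {B : A}
    {p : B ⟶ C.obj E.left}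
    {q : B ⟶ X} (h : IsPullback p q (C.map E.hom) (adj.unit.app X)) :
    IsIso ((sliceAdj adj X).counit.app E) ↔ IsIso (S.map p ≫ adj.counit.app E.left) := by
  have e : S.map p ≫ adj.counit.app E.left = S.map h.isoPullback.hom ≫
      S.map (pullback.fst (C.map E.hom) (adj.unit.app X)) ≫ adj.counit.app E.left := by
    rw [← S.map_comp_assoc, h.isoPullback_hom_fst]
  rw [e, isIso_comp_left_iff]
  constructor
  · intro
    have : IsIso ((Over.forget _).map ((sliceAdj adj X).counit.app E)) := inferInstance
    rwa [Over.forget_map, sliceAdj_counit_app_left] at this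
  · intro h'
    have : IsIso ((Over.forget _).map ((sliceAdj adj X).counit.app E)) := by
      rwa [Over.forget_map, sliceAdj_counit_app_left]
    exact isIso_of_reflects_iso _ (Over.forget _)

end Janelidze

namespace DiffObj

variable {A : Type u₁} [Category.{v₁} A] {P : Type u₂} [Category.{v₂} P] [HasPullbacks A]
  {S : A ⥤ P} {C : P ⥤ A} (adj : S ⊣ C) {X Y : DiffObj A}

theorem isTrivial_iff (a : Over X) : IsTrivial (mapAdjunction adj) X a ↔
    IsTrivial adj X.pt ((Over.post (forget A)).obj a) :=
  (isTrivial_iff_isPullback _ a).trans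
    (isPullback_iff.trans (isTrivial_iff_isPullback adj ((Over.post (forget A)).obj a)).symm)

theorem isSplit_iff (f : X ⟶ Y) (a : Over Y) : IsSplit (mapAdjunction adj) f a ↔
    IsSplit adj f.hom ((Over.post (forget A)).obj a) := by
  have h := IsPullback.of_hasPullback a.hom f
  rw [isSplit_iff_isTrivial (mapAdjunction adj) (b := Over.mk (pullback.snd a.hom f)) h,
    isTrivial_iff]
  exact (isSplit_iff_isTrivial adj (a := (Over.post (forget A)).obj a)
    (b := (Over.post (forget A)).obj (Over.mk (pullback.snd a.hom f))) (isPullback_iff.1 h)).symm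

theorem isIso_counit (h : IsIso (sliceAdj adj X.pt).counit) :
    IsIso (sliceAdj (mapAdjunction adj) X).counit := by
  have h' : ∀ E, IsIso ((sliceAdj adj X.pt).counit.app E) := fun E => inferInstance
  have : ∀ E, IsIso ((sliceAdj (mapAdjunction adj) X).counit.app E) := by
    intro E
    -- The chosen pullback of difference objects need not lie over the chosen underlying one, hence
    -- the criterion for arbitrary pullbacks.
    have hE := IsPullback.of_hasPullback ((mapFunctor C).map E.hom) ((mapAdjunction adj).unit.app X)
    rw [isIso_counit_app_iff _ hE, isIso_iff]
    exact (isIso_counit_app_iff adj (E := (Over.post (forget P)).obj E) (isPullback_iff.1 hE)).1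
      (h' _)
  exact NatIso.isIso_of_isIso_app _

/-- The underlying object is, up to isomorphism, the one built from the underlying E, and triviality
is invariant under isomorphism. -/
theorem isSplit_map_sliceC (f : X ⟶ Y)
    (h : ∀ E : Over (S.obj X.pt), IsSplit adj f.hom
      ((Over.map f.hom).obj ((sliceC adj X.pt).obj E)))
    (E : Over ((mapFunctor S).obj X)) :
    IsSplit (mapAdjunction adj) f ((Over.map f).obj ((sliceC (mapAdjunction adj) X).obj E)) := by
  rw [isSplit_iff]
  have hE := isPullback_iff.1 (IsPullback.of_hasPullback ((mapFunctor C).map E.hom)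
    ((mapAdjunction adj).unit.app X))
  refine (IsTrivial adj X.pt).prop_of_iso ((Over.pullback f.hom).mapIso ?_)
    (h ((Over.post (forget P)).obj E))
  exact (Over.map f.hom).mapIso (Over.isoMk hE.isoPullback.symm (by exact hE.isoPullback_inv_snd) :
    (sliceC adj X.pt).obj ((Over.post (forget P)).obj E) ≅
      (Over.post (forget A)).obj ((sliceC (mapAdjunction adj) X).obj E))

end DiffObj

/-! ### Coequalizers in slices -/

namespace CategoryTheory

section

variable {C : Type u₁} [Category.{v₁} C] {D : Type u₂} [Category.{v₂} D]

/-- The morphism `q` is a coequalizer of `g` and `h`. -/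
structure IsCoequalizer {a b c : C} (g h : a ⟶ b) (q : b ⟶ c) : Prop where
  w : g ≫ q = h ≫ q
  existsUnique : ∀ {t : C} (k : b ⟶ t), g ≫ k = h ≫ k → ∃! l : c ⟶ t, q ≫ l = k

namespace IsCoequalizer

variable {a b c : C} {g h : a ⟶ b} {q : b ⟶ c}

theorem hom_ext (H : IsCoequalizer g h q) {t : C} {l l' : c ⟶ t} (e : q ≫ l = q ≫ l') : l = l' :=
  (H.existsUnique (q ≫ l) (by rw [reassoc_of% H.w])).unique rfl e.symm

theorem nonempty_isColimit (H : IsCoequalizer g h q) :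
    Nonempty (IsColimit (Cofork.ofπ q H.w)) :=
  ⟨Cofork.IsColimit.ofExistsUnique fun s => H.existsUnique s.π s.condition⟩

theorem of_isColimit {w : g ≫ q = h ≫ q} (H : IsColimit (Cofork.ofπ q w)) :
    IsCoequalizer g h q :=
  ⟨w, fun k hk => Cofork.IsColimit.existsUnique H k hk⟩

theorem map (H : IsCoequalizer g h q) (F : C ⥤ D) [PreservesColimit (parallelPair g h) F] :
    IsCoequalizer (F.map g) (F.map h) (F.map q) :=
  of_isColimit (isColimitCoforkMapOfIsColimit F H.w H.nonempty_isColimit.some)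

theorem preservesColimit (H : IsCoequalizer g h q) {F : C ⥤ D}
    (HF : IsCoequalizer (F.map g) (F.map h) (F.map q)) :
    PreservesColimit (parallelPair g h) F :=
  preservesColimit_of_preserves_colimit_cocone H.nonempty_isColimit.some
    ((isColimitMapCoconeCoforkEquiv F H.w).symm HF.nonempty_isColimit.some)

theorem of_natIso {F G : C ⥤ D} (e : F ≅ G) (H : IsCoequalizer (F.map g) (F.map h) (F.map q)) :
    IsCoequalizer (G.map g) (G.map h) (G.map q) where
  w := by
    rw [← cancel_epi (e.hom.app a), ← e.hom.naturality_assoc, ← e.hom.naturality_assoc,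
      ← e.hom.naturality, reassoc_of% H.w]
  existsUnique {t} k hk := by
    obtain ⟨l, hl, hu⟩ := H.existsUnique (e.hom.app b ≫ k) (by
      rw [e.hom.naturality_assoc, e.hom.naturality_assoc, hk])
    refine ⟨e.inv.app c ≫ l, ?_, fun m hm => ?_⟩
    · simp [hl]
    · rw [← hu (e.hom.app c ≫ m) (by simp [hm])]
      simp

end IsCoequalizer

theorem hasSplitCoequalizer_of_natIso {F G : C ⥤ D} (e : F ≅ G) {a b : C} (g h : a ⟶ b)
    (H : HasSplitCoequalizer (F.map g) (F.map h)) : HasSplitCoequalizer (G.map g) (G.map h) := by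
  obtain ⟨c, q, ⟨s⟩⟩ := H.splittable
  refine ⟨⟨c, e.inv.app b ≫ q, ⟨⟨s.rightSection ≫ e.hom.app b,
    e.inv.app b ≫ s.leftSection ≫ e.hom.app a, ?_, ?_, ?_, ?_⟩⟩⟩⟩
  · rw [e.inv.naturality_assoc, e.inv.naturality_assoc, s.condition]
  · simp
  · rw [Category.assoc, Category.assoc, ← e.hom.naturality, s.leftSection_bottom_assoc]
    simp
  · rw [Category.assoc, Category.assoc, ← e.hom.naturality, s.leftSection_top_assoc]
    simp

/-- In a slice, a coequalizer has the universal property of a coequalizer also with respect to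
morphisms lying over a morphism of the base. -/
theorem IsCoequalizer.exists_over [HasPullbacks C] {Y Z : C} {a b c : Over Y} {g h : a ⟶ b}
    {q : b ⟶ c} (H : IsCoequalizer g h q) (t : Y ⟶ Z) {d : Over Z} (k : b.left ⟶ d.left)
    (hk : k ≫ d.hom = b.hom ≫ t) (w : g.left ≫ k = h.left ≫ k) :
    ∃ l : c.left ⟶ d.left, l ≫ d.hom = c.hom ≫ t ∧ q.left ≫ l = k := by
  -- Morphisms over t are morphisms out of the image under `Over.map t`, a left adjoint, which
  -- preserves coequalizers.
  obtain ⟨l, hl, -⟩ := (H.map (Over.map t)).existsUnique (Over.homMk k hk) (by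
    apply Over.OverMorphism.ext
    exact w)
  exact ⟨l.left, Over.w l, congrArg (fun k => k.left) hl⟩

theorem IsCoequalizer.hom_ext_over [HasPullbacks C] {Y Z : C} {a b c : Over Y} {g h : a ⟶ b}
    {q : b ⟶ c} (H : IsCoequalizer g h q) (t : Y ⟶ Z) {d : Over Z} {l l' : c.left ⟶ d.left}
    (hl : l ≫ d.hom = c.hom ≫ t) (hl' : l' ≫ d.hom = c.hom ≫ t)
    (w : q.left ≫ l = q.left ≫ l') : l = l' := by
  have := (H.map (Over.map t)).hom_ext (t := d) (l := Over.homMk l hl) (l' := Over.homMk l' hl')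
    (Over.OverMorphism.ext w)
  exact congrArg (fun k => k.left) this

theorem MonadicRightAdjoint.reflectsIsomorphisms {C : Type u₁} [Category.{v₁} C] {D : Type u₂}
    [Category.{v₁} D] (G : D ⥤ C) [MonadicRightAdjoint G] : G.ReflectsIsomorphisms :=
  inferInstanceAs (Monad.comparison (monadicAdjunction G) ⋙
    (monadicAdjunction G).toMonad.forget).ReflectsIsomorphisms

end

end CategoryTheory

/-! ### Monadicity for difference objects -/

namespace DiffObj

variable {A : Type u₁} [Category.{v₁} A] [HasPullbacks A] {X Y : DiffObj A}

/-- The functor from the slice over a difference object to the slice over the underlying object. -/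
def overForget (Y : DiffObj A) : Over Y ⥤ Over Y.pt :=
  Over.post (forget A)

/-- The pullback functors commute with the functors to the underlying slices. -/
noncomputable def pullbackCompOverForget (f : X ⟶ Y) :
    Over.pullback f ⋙ overForget X ≅ overForget Y ⋙ Over.pullback f.hom :=
  NatIso.ofComponents
    (fun a => Over.isoMk (isPullback_iff.1 (IsPullback.of_hasPullback a.hom f)).isoPullback
      (IsPullback.isoPullback_hom_snd _))
    (fun {a b} u => by
      have ha := isPullback_iff.1 (IsPullback.of_hasPullback a.hom f)
      have hb := isPullback_iff.1 (IsPullback.of_hasPullback b.hom f)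
      have h₁ : ((Over.pullback f).map u).left ≫ pullback.fst b.hom f =
          pullback.fst a.hom f ≫ u.left := pullback.lift_fst _ _ _
      have h₂ : ((Over.pullback f).map u).left ≫ pullback.snd b.hom f =
          pullback.snd a.hom f := pullback.lift_snd _ _ _
      have k₁ : ((Over.pullback f.hom).map ((overForget Y).map u)).left ≫
          pullback.fst b.hom.hom f.hom = pullback.fst a.hom.hom f.hom ≫ u.left.hom :=
        pullback.lift_fst _ _ _
      have k₂ : ((Over.pullback f.hom).map ((overForget Y).map u)).left ≫
          pullback.snd b.hom.hom f.hom = pullback.snd a.hom.hom f.hom :=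
        pullback.lift_snd _ _ _
      refine Over.OverMorphism.ext ?_
      change ((Over.pullback f).map u).left.hom ≫ hb.isoPullback.hom = ha.isoPullback.hom ≫
        ((Over.pullback f.hom).map ((overForget Y).map u)).left
      refine pullback.hom_ext ?_ ?_
      · refine (Category.assoc _ _ _).trans (Eq.trans ?_ (Category.assoc _ _ _).symm)
        refine (congrArg (fun k => ((Over.pullback f).map u).left.hom ≫ k)
          hb.isoPullback_hom_fst).trans ((congrArg Hom.hom h₁).trans ?_)
        refine Eq.trans ?_ (congrArg (fun k => ha.isoPullback.hom ≫ k) k₁.symm)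
        exact (congrArg (fun k => k ≫ u.left.hom) ha.isoPullback_hom_fst.symm).trans
          (Category.assoc _ _ _)
      · refine (Category.assoc _ _ _).trans (Eq.trans ?_ (Category.assoc _ _ _).symm)
        refine (congrArg (fun k => ((Over.pullback f).map u).left.hom ≫ k)
          hb.isoPullback_hom_snd).trans ((congrArg Hom.hom h₂).trans ?_)
        exact ha.isoPullback_hom_snd.symm.trans
          (congrArg (fun k => ha.isoPullback.hom ≫ k) k₂.symm))

/-- A cofork in a slice of the category of difference objects is a coequalizer if the underlying
cofork is. -/
theorem isCoequalizer_of_overForget {a b c : Over Y} {g h : a ⟶ b} {q : b ⟶ c}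
    (H : IsCoequalizer ((overForget Y).map g) ((overForget Y).map h)
      ((overForget Y).map q)) : IsCoequalizer g h q where
  w := Over.OverMorphism.ext (DiffObj.hom_ext (congrArg (fun k => k.left) H.w))
  existsUnique {t} k hk := by
    obtain ⟨l, hl, hu⟩ := H.existsUnique ((overForget Y).map k) (by
      rw [← Functor.map_comp, ← Functor.map_comp, hk])
    obtain ⟨m, hm, hl', hw⟩ : ∃ m : c.left.pt ⟶ t.left.pt, l.left = m ∧
        q.left.hom ≫ m = k.left.hom ∧ m ≫ t.hom.hom = c.hom.hom :=
      ⟨l.left, rfl, congrArg (fun k => k.left) hl, Over.w l⟩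
    -- Both composites lie over σ_Y, not over the identity, so uniqueness is needed in its form over
    -- a base morphism.
    have e : m ≫ t.left.σ = c.left.σ ≫ m := by
      refine H.hom_ext_over (d := (overForget Y).obj t) Y.σ ?_ ?_ ?_
      · change (m ≫ t.left.σ) ≫ t.hom.hom = c.hom.hom ≫ Y.σ
        rw [Category.assoc, ← t.hom.comm, reassoc_of% hw]
      · change (c.left.σ ≫ m) ≫ t.hom.hom = c.hom.hom ≫ Y.σ
        rw [Category.assoc, hw, c.hom.comm]
      · change q.left.hom ≫ m ≫ t.left.σ = q.left.hom ≫ c.left.σ ≫ m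
        rw [reassoc_of% hl', ← Category.assoc, q.left.comm, Category.assoc, hl', k.left.comm]
    refine ⟨Over.homMk ⟨m, e⟩ (DiffObj.hom_ext hw),
      Over.OverMorphism.ext (DiffObj.hom_ext hl'), fun n hn => ?_⟩
    have := hu ((overForget Y).map n) 
      (((overForget Y).map_comp q n).symm.trans (congrArg _ hn))
    exact Over.OverMorphism.ext (DiffObj.hom_ext ((congrArg (fun k => k.left) this).trans hm))

/-- A coequalizer of the underlying pair in the slice over `Y` lifts to a cofork of difference
objects. -/
theorem exists_of_isCoequalizer_overForget {a b : Over Y} {g h : a ⟶ b} {c₀ : Over Y.pt}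
    {q₀ : (overForget Y).obj b ⟶ c₀}
    (H : IsCoequalizer ((overForget Y).map g) ((overForget Y).map h) q₀) :
    ∃ (c : Over Y) (q : b ⟶ c), IsCoequalizer ((overForget Y).map g)
      ((overForget Y).map h) ((overForget Y).map q) := by
  obtain ⟨r, hr, hw, hH⟩ : ∃ r : b.left.pt ⟶ c₀.left, q₀.left = r ∧ r ≫ c₀.hom = b.hom.hom ∧
      g.left.hom ≫ r = h.left.hom ≫ r :=
    ⟨q₀.left, rfl, Over.w q₀, congrArg (fun k => k.left) H.w⟩
  -- The operator on the coequalizer is induced by that of b, over σ_Y.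
  obtain ⟨σ, hσ, hq⟩ := H.exists_over Y.σ (d := c₀) (b.left.σ ≫ r)
    (by
      change (b.left.σ ≫ r) ≫ c₀.hom = b.hom.hom ≫ Y.σ
      rw [Category.assoc, hw, b.hom.comm])
    (by
      change g.left.hom ≫ b.left.σ ≫ r = h.left.hom ≫ b.left.σ ≫ r
      rw [← Category.assoc, g.left.comm, Category.assoc, hH, ← Category.assoc, ← h.left.comm,
        Category.assoc])
  let c : DiffObj A := ⟨c₀.left, σ⟩
  let p : c ⟶ Y := ⟨c₀.hom, hσ.symm⟩
  let q : b.left ⟶ c := ⟨q₀.left, hq.trans (congrArg _ hr.symm)⟩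
  exact ⟨Over.mk p, Over.homMk q (DiffObj.hom_ext (Over.w q₀)), H⟩

/-- Beck's criterion: an f^*-split pair has an underlying split pair, whose coequalizer exists and
is preserved by the monadic underlying pullback functor. It lifts to difference objects, and both
coequalizer properties are detected underneath, as are isomorphisms. -/
theorem nonempty_monadic (f : X ⟶ Y) (hf : Nonempty (MonadicRightAdjoint (Over.pullback f.hom))) :
    Nonempty (MonadicRightAdjoint (Over.pullback f)) := by
  obtain ⟨_⟩ := hf
  have key : ∀ {a b : Over Y} (g h : a ⟶ b) [(Over.pullback f).IsSplitPair g h],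
      ∃ (c : Over Y) (q : b ⟶ c), IsCoequalizer g h q ∧ IsCoequalizer ((Over.pullback f).map g)
        ((Over.pullback f).map h) ((Over.pullback f).map q) := by
    intro a b g h _
    let g₀ := (overForget Y).map g
    let h₀ := (overForget Y).map h
    have hs : (Over.pullback f.hom).IsSplitPair g₀ h₀ :=
      hasSplitCoequalizer_of_natIso (pullbackCompOverForget f) g h
        (map_is_split_pair (overForget X) ((Over.pullback f).map g)
          ((Over.pullback f).map h))
    let _ := Monad.createsGSplitCoequalizersOfMonadic (Over.pullback f.hom) g₀ h₀
    have : HasColimit (parallelPair g₀ h₀ ⋙ Over.pullback f.hom) := by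
      rw [hasColimit_iff_of_iso (diagramIsoParallelPair.{v₁} _)]
      exact inferInstanceAs <| HasCoequalizer ((Over.pullback f.hom).map g₀)
        ((Over.pullback f.hom).map h₀)
    have : HasCoequalizer g₀ h₀ := hasColimit_of_created (parallelPair _ _) (Over.pullback f.hom)
    obtain ⟨c, q, H⟩ := exists_of_isCoequalizer_overForget
      (IsCoequalizer.of_isColimit (coequalizerIsCoequalizer g₀ h₀))
    refine ⟨c, q, isCoequalizer_of_overForget H, isCoequalizer_of_overForget ?_⟩
    exact IsCoequalizer.of_natIso (F := overForget Y ⋙ Over.pullback f.hom)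
      (G := Over.pullback f ⋙ overForget X) (pullbackCompOverForget f).symm
      (H.map (Over.pullback f.hom))
  have : Monad.HasCoequalizerOfIsSplitPair (Over.pullback f) := ⟨fun g h _ => by
    obtain ⟨c, q, H, -⟩ := key g h
    exact ⟨⟨_, H.nonempty_isColimit.some⟩⟩⟩
  have : Monad.PreservesColimitOfIsSplitPair (Over.pullback f) := ⟨fun g h _ => by
    obtain ⟨c, q, H, H'⟩ := key g h
    exact H.preservesColimit H'⟩
  have : (Over.pullback f).ReflectsIsomorphisms := ⟨fun {a b} u hu => by
    have hr := MonadicRightAdjoint.reflectsIsomorphisms (Over.pullback f.hom)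
    have h₁ : IsIso ((overForget X).map ((Over.pullback f).map u)) := inferInstance
    have h₂ : IsIso ((Over.pullback f.hom).map ((overForget Y).map u)) :=
      (NatIso.isIso_map_iff (pullbackCompOverForget f) u).1 h₁
    have h₃ : IsIso ((overForget Y).map u) := isIso_of_reflects_iso _ (Over.pullback f.hom)
    have h₄ : IsIso ((Over.forget _).map ((overForget Y).map u)) := inferInstance
    have h₅ : IsIso ((Over.forget _).map u) := (isIso_iff u.left).2 h₄
    exact isIso_of_reflects_iso _ (Over.forget _)⟩
  exact ⟨Monad.monadicOfHasPreservesGSplitCoequalizersOfReflectsIsomorphisms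
    (Over.mapPullbackAdj f)⟩

theorem isRelativeGaloisDescent {P : Type u₂} [Category.{v₂} P] {S : A ⥤ P} {C : P ⥤ A}
    (adj : S ⊣ C) (f : X ⟶ Y) (hf : IsRelativeGaloisDescent adj f.hom) :
    IsRelativeGaloisDescent (mapAdjunction adj) f where
  monadic := nonempty_monadic f hf.monadic
  isIso_counit := isIso_counit adj hf.isIso_counit
  isSplit := isSplit_map_sliceC adj f hf.isSplit

end DiffObj

theorem theorem3p5 {A₀ : Type u₁} [Category.{v₁} A₀] {P₀ : Type u₂} [Category.{v₂} P₀]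
    [HasPullbacks A₀] {S₀ : A₀ ⥤ P₀} {C₀ : P₀ ⥤ A₀} (adj₀ : S₀ ⊣ C₀)
    {X Y : DiffObj A₀} (f : X ⟶ Y) (hf : IsRelativeGaloisDescent adj₀ f.hom) :
    IsRelativeGaloisDescent (DiffObj.mapAdjunction adj₀) f ∧
    (∀ a : Over Y, IsSplit (DiffObj.mapAdjunction adj₀) f a ↔
      IsSplit adj₀ f.hom ((Over.post (DiffObj.forget A₀)).obj a)) ∧
    ∃ (hG : (galData (DiffObj.mapFunctor S₀) f).IsGroupoid)
      (Φ : Split (DiffObj.mapAdjunction adj₀) f ≌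
        InternalAction ⟨galData (DiffObj.mapFunctor S₀) f, hG⟩)
      (θ : Φ.functor ⋙ InternalAction.toOver _ ≅
        (IsSplit (DiffObj.mapAdjunction adj₀) f).ι ⋙ Over.pullback f ⋙
          sliceS (DiffObj.mapFunctor S₀) X),
      ∀ a : Split (DiffObj.mapAdjunction adj₀) f,
        IsCanonicalAction f hG a.obj (Φ.functor.obj a) (θ.app a) := by
  have h := DiffObj.isRelativeGaloisDescent adj₀ f hf
  exact ⟨h, DiffObj.isSplit_iff adj₀ f, h.exists_equivalence⟩
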